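/- Let $\Sigma$ be a finite alphabet. A set of $\omega$-words is $\omega$-regular if it is accepted by a finite nondeterministic Büchi automaton; a binary relation on $\Sigma^\omega$ is $\omega$-regular if a Büchi automaton over $\Sigma\times\Sigma$ accepts exactly the convolutions $x\otimes y=(x[0],y[0])(x[1],y[1])\cdots$ of the related pairs $(x,y)$. Two words $x,y\in\Sigma^\omega$ have equal ends, written $x\sim_e y$, if $x[n]=y[n]$ for all but finitely many $n$. Let $\approx$ be an equivalence relation on a set $D\subseteq\Sigma^\omega$ (for instance $D=\Sigma^\omega$) which is $\omega$-regular as a set of pairs. Then there is a constant $C\in\mathbb{N}$, depending on $\approx$, such that the following are equivalent: 1. $\approx$ has countably many (that is, finitely or countably infinitely many) equivalence classes; 2. there are $C$ (not necessarily distinct) $\sim_e$-classes such that every $\approx$-class has non-empty intersection with at least one of them. In this case there is an $\omega$-regular set $R\subseteq D$ that contains exactly one element of every $\approx$-class. Moreover, a Büchi automaton for such a set can be effectively computed from a Büchi automaton for $\approx$: there is an algorithm (a partial recursive function) that, given any finite alphabet $\Sigma=\{0,\dots,k-1\}$ and any Büchi automaton accepting an equivalence relation $\approx$ on some $D\subseteq\Sigma^\omega$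 with countably many classes, halts and outputs a Büchi automaton accepting a set that contains exactly one element of every $\approx$-class and is contained in $D$. -/

import Mathlib

/-- A finite nondeterministic Büchi automaton over the alphabet `α`. States are named by natural
numbers; only the finitely many states that occur in the lists matter. A triple `(p, a, q)` in
`transitions` is a transition from `p` to `q` that reads the letter `a`. -/
structure BuchiAutomaton (α : Type*) where
  initial : List ℕ
  transitions : List (ℕ × α × ℕ)
  accepting : List ℕ

namespace BuchiAutomaton

/-- An automaton is the same thing as the triple of its lists; this is used as its encoding. -/
def equivProd (α : Type*) :
    BuchiAutomaton α ≃ List ℕ × List (ℕ × α × ℕ) × List ℕ where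
  toFun A := (A.initial, A.transitions, A.accepting)
  invFun p := ⟨p.1, p.2.1, p.2.2⟩
  left_inv _ := rfl
  right_inv _ := rfl

instance instPrimcodable (α : Type*) [Primcodable α] : Primcodable (BuchiAutomaton α) :=
  Primcodable.ofEquiv _ (equivProd α)

/-- `ρ` is a run of `A` on the infinite word `w`. -/
def IsRun {α : Type*} (A : BuchiAutomaton α) (w : ℕ → α) (ρ : ℕ → ℕ) : Prop :=
  ρ 0 ∈ A.initial ∧ ∀ i, (ρ i, w i, ρ (i + 1)) ∈ A.transitions

/-- Büchi acceptance: some run on `w` visits accepting states infinitely often. -/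
def Accepts {α : Type*} (A : BuchiAutomaton α) (w : ℕ → α) : Prop :=
  ∃ ρ : ℕ → ℕ, A.IsRun w ρ ∧ ∃ᶠ i in Filter.atTop, ρ i ∈ A.accepting

end BuchiAutomaton

/-- The convolution of two infinite words: the word of pairs of letters. -/
def convolution {α β : Type*} (x : ℕ → α) (y : ℕ → β) : ℕ → α × β :=
  fun i => (x i, y i)

/-- A set of infinite words is ω-regular if a Büchi automaton accepts exactly its members. -/
def IsOmegaRegular {α : Type*} (L : Set (ℕ → α)) : Prop :=
  ∃ A : BuchiAutomaton α, ∀ w, w ∈ L ↔ A.Accepts w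

/-- A binary relation on infinite words is ω-regular if a Büchi automaton reading both words
synchronously, letter by letter, accepts exactly the related pairs. -/
def IsOmegaRegularRel {α : Type*} (r : (ℕ → α) → (ℕ → α) → Prop) : Prop :=
  ∃ A : BuchiAutomaton (α × α), ∀ x y, r x y ↔ A.Accepts (convolution x y)

/-- Two infinite words have equal ends if they agree at all but finitely many positions. -/
def equalEnds (α : Type*) : Setoid (ℕ → α) where
  r x y := ∀ᶠ n in Filter.atTop, x n = y n
  iseqv :=
    { refl := fun _ => Filter.Eventually.of_forall fun _ => rfl
      symm := fun h => h.mono fun _ => Eq.symm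
      trans := fun h h' => (h.and h').mono fun _ p => p.1.trans p.2 }

/-- `r` is an equivalence relation on the set `D` (and relates no elements outside of `D`). -/
structure IsEquivalenceOn {X : Type*} (D : Set X) (r : X → X → Prop) : Prop where
  mem : ∀ {x y}, r x y → x ∈ D ∧ y ∈ D
  refl : ∀ {x}, x ∈ D → r x x
  symm : ∀ {x y}, r x y → r y x
  trans : ∀ {x y z}, r x y → r y z → r x z

/-- The set of equivalence classes of an equivalence relation `r` on `D`. -/
def classesOn {X : Type*} (D : Set X) (r : X → X → Prop) : Set (Set X) :=
  {c | ∃ x ∈ D, c = {y | r x y}}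

/-- Some `C` equal-ends classes (not necessarily distinct) together meet every class of `r`. -/
def MetByEqualEndsClasses {α : Type*} (D : Set (ℕ → α)) (r : (ℕ → α) → (ℕ → α) → Prop)
    (C : ℕ) : Prop :=
  ∃ E : Fin C → Quotient (equalEnds α),
    ∀ c ∈ classesOn D r, ∃ i, ∃ y ∈ c, (Quotient.mk (equalEnds α) y) = E i

/-- `R` is a set of unique representatives: it lies in `D` and has exactly one element in each
class of `r`. -/
def IsRepresentativeSet {X : Type*} (D : Set X) (r : X → X → Prop) (R : Set X) : Prop :=
  R ⊆ D ∧ ∀ c ∈ classesOn D r, ∃! x, x ∈ R ∧ x ∈ c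

/-- A word over the alphabet `{0, …, k - 1}` as a sequence of natural numbers, so that automata
over all finite alphabets can be inputs of one algorithm. -/
def natWord {k : ℕ} (x : ℕ → Fin k) : ℕ → ℕ :=
  fun i => (x i : ℕ)

open Filter

/-! ### Ramsey's theorem for pairs -/

/-! A Büchi automaton sees a finite word only through its profile: which states it connects, and
whether by way of an accepting state. Over finitely many states the profiles form a finite monoid,
so Ramsey's theorem cuts every infinite word into one block of value `s` and then blocks of a single
idempotent value `e`; the pair `(s, e)` decides acceptance (`NBA.accepts_iff_of_isFactorization`).
This gives complementation (`Saturates.reg_compl`), hence closure of the ω-regular sets under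
Boolean operations and projection.

Over a finite alphabet every equal-ends class is countable, so finitely many of them can meet only
countably many classes. For the converse (`exists_finite_meeting_of_countable`), suppose that
finitely many ends never suffice. Choose more words than the monoid has elements, such that the ends
of no earlier word occur in the class of a later one. Ramsey on all pairs at once and the pigeonhole
principle yield two of them whose pairings with themselves have the same block values. Splice their
blocks according to a set `b` of indices. For `b ⊆ b'`, idempotence makes relatedness of the two
mixtures independent of the choice, as long as the sets agree and differ infinitely often
(`mix_mem_iff`). Related mixtures would bring the ends of the earlier word into the class of the
later one. So they are unrelated, and a chain of continuum many sets, made of Dedekind cuts,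
contradicts countability.

For representatives, the tuples of words whose ends meet all classes form an ω-regular set, so an
ultimately periodic tuple exists (`exists_regular_meeting`). In each class one takes the first track
whose ends occur, and the least word with those ends in an order that looks at the last difference
and ranks the letter of the track lowest.

The algorithm does not make these constructions effective. It searches for an automaton `P` relating
words to their representatives, together with a finite certificate of its correctness: a set of
profiles closed under products whose linked pairs all behave as required. Checking is primitive
recursive; Ramsey gives soundness, ultimately periodic words give completeness
(`exists_isListCertificate_iff`). -/

theorem exists_strictMono_homogeneous {κ : Type*} [Finite κ] (c : ℕ → ℕ → κ) :
    ∃ (h : ℕ → ℕ) (t : κ), StrictMono h ∧ ∀ a b, a < b → c (h a) (h b) = t := by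
  -- Along a nonprincipal ultrafilter every finite colouring is constant. Below, `u a` is the limit
  -- colour of row `a`, and `t` is the limit of these colours.
  have pigeon : ∀ g : ℕ → κ, ∃ t, ∀ᶠ n in (hyperfilter ℕ : Filter ℕ), g n = t := by
    intro g
    by_contra! hg
    obtain ⟨n, hn⟩ := (eventually_all.2 hg).exists
    exact hn _ rfl
  choose u hu using fun a => pigeon (c a)
  obtain ⟨t, ht⟩ := pigeon u
  have hgt : ∀ a, ∀ᶠ n in (hyperfilter ℕ : Filter ℕ), a < n := fun a =>
    (Nat.hyperfilter_le_atTop (eventually_gt_atTop a))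
  obtain ⟨h, -, hh⟩ := exists_seq_of_forall_finset_exists (fun a => u a = t)
    (fun a b => a < b ∧ c a b = t) (by
      intro s hs
      have : ∀ᶠ n in (hyperfilter ℕ : Filter ℕ), ∀ a ∈ s, a < n ∧ c a n = t := by
        refine (eventually_all_finset s).2 fun a ha => ?_
        filter_upwards [hgt a, hu a] with n h1 h2
        exact ⟨h1, h2.trans (hs a ha)⟩
      obtain ⟨n, h1, h2⟩ := (ht.and this).exists
      exact ⟨n, h1, h2⟩)
  exact ⟨h, t, strictMono_nat_of_lt_succ fun n => (hh n _ n.lt_succ_self).1,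
    fun a b hab => (hh a b hab).2⟩

/-! ### Cutting an infinite word into blocks -/

/-- The index `n` of the block `[h n, h (n + 1))` that contains `i`. -/
def blockIndex (h : ℕ → ℕ) (i : ℕ) : ℕ := Nat.findGreatest (fun n => h n ≤ i) i

section blockIndex
variable {h : ℕ → ℕ}

theorem blockIndex_le (h0 : h 0 = 0) (i : ℕ) : h (blockIndex h i) ≤ i :=
  Nat.findGreatest_spec (P := fun n => h n ≤ i) (Nat.zero_le i) (by simp [h0])

theorem lt_blockIndex_succ (hh : StrictMono h) (i : ℕ) : i < h (blockIndex h i + 1) := by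
  by_contra! hc
  have := Nat.le_findGreatest (P := fun n => h n ≤ i) ((hh.id_le _).trans hc) hc
  exact absurd this (by simp [blockIndex])

theorem blockIndex_eq (hh : StrictMono h) (h0 : h 0 = 0) {n i : ℕ} (h1 : h n ≤ i)
    (h2 : i < h (n + 1)) : blockIndex h i = n := by
  have h3 := blockIndex_le h0 i
  have h4 := lt_blockIndex_succ hh i
  have h5 := hh.lt_iff_lt.1 (h1.trans_lt h4)
  have h6 := hh.lt_iff_lt.1 (h3.trans_lt h2)
  omega

theorem le_blockIndex (hh : StrictMono h) {n i : ℕ} (h1 : h n ≤ i) : n ≤ blockIndex h i :=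
  Nat.lt_succ_iff.1 (hh.lt_iff_lt.1 (h1.trans_lt (lt_blockIndex_succ hh i)))

end blockIndex

/-- The product of the values of `φ` on the letters of `w` at the positions in `[a, b)`. -/
def seg {α M : Type*} [Monoid M] (φ : α → M) (w : ℕ → α) (a b : ℕ) : M :=
  ((List.Ico a b).map fun i => φ (w i)).prod

section seg
variable {α M : Type*} [Monoid M] {φ : α → M} {w w' : ℕ → α} {a b c : ℕ}

theorem seg_mul (hab : a ≤ b) (hbc : b ≤ c) : seg φ w a b * seg φ w b c = seg φ w a c := by
  rw [seg, seg, seg, ← List.prod_append, ← List.map_append, List.Ico.append_consecutive hab hbc]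

@[simp] theorem seg_self : seg φ w a a = 1 := by simp [seg]

@[simp] theorem seg_succ_self : seg φ w a (a + 1) = φ (w a) := by simp [seg]

theorem seg_succ (hab : a ≤ b) : seg φ w a (b + 1) = seg φ w a b * φ (w b) := by
  rw [← seg_mul hab b.le_succ, seg_succ_self]

theorem seg_congr (H : ∀ i, a ≤ i → i < b → w i = w' i) : seg φ w a b = seg φ w' a b := by
  unfold seg
  congr 1
  refine List.map_congr_left fun i hi => ?_
  rw [List.Ico.mem] at hi
  rw [H i hi.1 hi.2]

theorem seg_eq_of_idempotent {h : ℕ → ℕ} {e : M} (hh : Monotone h) (he : e * e = e) {m n : ℕ}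
    (hmn : m < n) (H : ∀ i, m ≤ i → i < n → seg φ w (h i) (h (i + 1)) = e) :
    seg φ w (h m) (h n) = e := by
  induction n, hmn using Nat.le_induction with
  | base => exact H m le_rfl (Nat.lt_succ_self m)
  | succ n hmn ih =>
    have hmn' : m ≤ n := Nat.le_of_succ_le hmn
    rw [← seg_mul (hh hmn') (hh n.le_succ), ih fun i h1 h2 => H i h1 (h2.trans n.lt_succ_self),
      H n hmn' n.lt_succ_self, he]

end seg

/-- The values of a cut word: `s` for the block before the first cut, `e` between any two cuts. -/
structure IsFactorization {α M : Type*} [Monoid M] (φ : α → M) (w : ℕ → α) (h : ℕ → ℕ)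
    (s e : M) : Prop where
  strictMono : StrictMono h
  zero : h 0 = 0
  first : seg φ w 0 (h 1) = s
  other : ∀ n, 1 ≤ n → seg φ w (h n) (h (n + 1)) = e
  idem : e * e = e
  absorb : s * e = s

/-- Finiteness is asked only of the values that occur: certificates use profiles over `ℕ × ℕ`, an
infinite monoid, and need `s` and `e` inside the certificate. -/
theorem exists_isFactorization_of_finite_range {α M : Type*} [Monoid M] (φ : α → M) (w : ℕ → α)
    {K : Set M} (hK : K.Finite) (hw : ∀ a b, a < b → seg φ w a b ∈ K) :
    ∃ h s e, IsFactorization φ w h s e ∧ s ∈ K ∧ e ∈ K := by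
  have := hK.to_subtype
  obtain ⟨H, t, hH, ht⟩ := exists_strictMono_homogeneous (κ := Option K) fun a b =>
    if hab : a < b then some ⟨seg φ w a b, hw a b hab⟩ else none
  obtain ⟨e, he, hc⟩ : ∃ e ∈ K, ∀ a b, a < b → seg φ w (H a) (H b) = e := by
    have h3 := ht 0 1 Nat.zero_lt_one
    rw [dif_pos (hH Nat.zero_lt_one)] at h3
    refine ⟨_, hw _ _ (hH Nat.zero_lt_one), fun a b hab => ?_⟩
    have := ht a b hab
    rw [← h3, dif_pos (hH hab), Option.some_inj, Subtype.mk.injEq] at this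
    exact this
  have hH' : ∀ n, H n < H (n + 1) := fun n => hH n.lt_succ_self
  have idem : e * e = e := by
    have := seg_mul (φ := φ) (w := w) (hH' 0).le (hH' 1).le
    rwa [hc 0 1 (by omega), hc 1 2 (by omega), hc 0 2 (by omega)] at this
  have hpos : 0 < H 1 := (Nat.zero_le _).trans_lt (hH' 0)
  -- The cut `H 0` is replaced by `0`. The first block then ends in the factor `[H 0, H 1)` of value
  -- `e`, which is why `s * e = s`.
  refine ⟨fun n => if n = 0 then 0 else H n, seg φ w 0 (H 1), e,
    ⟨strictMono_nat_of_lt_succ fun n => ?_, rfl, rfl, fun n hn => ?_, idem, ?_⟩,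
    hw _ _ hpos, he⟩
  · rcases n with _ | n
    · simpa using hpos
    · simpa using hH' (n + 1)
  · simpa [Nat.one_le_iff_ne_zero.1 hn] using hc n (n + 1) n.lt_succ_self
  · rw [← seg_mul (φ := φ) (w := w) (Nat.zero_le _) (hH' 0).le, hc 0 1 (by omega), mul_assoc, idem]

theorem exists_isFactorization {α M : Type*} [Monoid M] [Finite M] (φ : α → M) (w : ℕ → α) :
    ∃ h s e, IsFactorization φ w h s e := by
  obtain ⟨h, s, e, H, -⟩ := exists_isFactorization_of_finite_range φ w (Set.toFinite Set.univ)
    fun _ _ _ => Set.mem_univ _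
  exact ⟨h, s, e, H⟩

/-! ### Büchi automata as transition relations, and their profiles -/

/-- A Büchi automaton with states in `Q`, given by its transition relation. -/
structure NBA (α Q : Type*) where
  start : Set Q
  step : Q → α → Q → Prop
  accept : Set Q

/-- A set of triples `(p, f, q)`: there is a path from `p` to `q` which meets an accepting state,
before its end, exactly if `f` is `true`. -/
@[ext] structure Profile (Q : Type*) where
  triples : Set (Q × Bool × Q)

namespace Profile

variable {Q : Type*}

instance [Finite Q] : Finite (Profile Q) :=
  Finite.of_injective Profile.triples fun _ _ h => Profile.ext h

/-- Concatenation of paths. -/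
def comp (X Y : Profile Q) : Profile Q :=
  ⟨{t | ∃ r f g, (t.1, f, r) ∈ X.triples ∧ (r, g, t.2.2) ∈ Y.triples ∧ t.2.1 = (f || g)}⟩

instance : Monoid (Profile Q) where
  mul := comp
  one := ⟨{t | t.1 = t.2.2 ∧ t.2.1 = false}⟩
  mul_assoc X Y Z := by
    ext ⟨p, f, q⟩
    constructor
    · rintro ⟨r, f₁, f₂, ⟨r', g₁, g₂, h1, h2, h3⟩, h4, h5⟩
      exact ⟨r', g₁, (g₂ || f₂), h1, ⟨r, g₂, f₂, h2, h4, rfl⟩, by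
        rw [← Bool.or_assoc, ← h3]; exact h5⟩
    · rintro ⟨r, f₁, f₂, h1, ⟨r', g₁, g₂, h2, h3, h4⟩, h5⟩
      exact ⟨r', (f₁ || g₁), g₂, ⟨r, f₁, g₁, h1, h2, rfl⟩, h3, by
        rw [Bool.or_assoc, ← h4]; exact h5⟩
  one_mul X := by
    ext ⟨p, f, q⟩
    constructor
    · rintro ⟨r, f₁, f₂, ⟨h1, h1'⟩, h2, h3⟩
      simp_all
    · exact fun h => ⟨p, false, f, ⟨rfl, rfl⟩, h, rfl⟩
  mul_one X := by
    ext ⟨p, f, q⟩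
    constructor
    · rintro ⟨r, f₁, f₂, h2, ⟨h1, h1'⟩, h3⟩
      simp_all
    · exact fun h => ⟨q, f, false, h, ⟨rfl, rfl⟩, by simp⟩

theorem mem_mul {X Y : Profile Q} {p q : Q} {f : Bool} : (p, f, q) ∈ (X * Y).triples ↔
    ∃ r f₁ f₂, (p, f₁, r) ∈ X.triples ∧ (r, f₂, q) ∈ Y.triples ∧ f = (f₁ || f₂) := Iff.rfl

theorem mem_one {p q : Q} {f : Bool} :
    (p, f, q) ∈ (1 : Profile Q).triples ↔ p = q ∧ f = false := Iff.rfl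

end Profile

namespace NBA

variable {α Q : Type*} (A : NBA α Q)

/-- Büchi acceptance. -/
def Accepts (w : ℕ → α) : Prop :=
  ∃ ρ : ℕ → Q, ρ 0 ∈ A.start ∧ (∀ i, A.step (ρ i) (w i) (ρ (i + 1))) ∧
    ∃ᶠ i in atTop, ρ i ∈ A.accept

/-- The profile of a letter. -/
def letter (a : α) : Profile Q :=
  ⟨{t | A.step t.1 a t.2.2 ∧ (t.2.1 = true ↔ t.1 ∈ A.accept)}⟩

variable {A} {w : ℕ → α}

theorem mem_seg {a b : ℕ} (hab : a ≤ b) {p q : Q} {f : Bool} :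
    (p, f, q) ∈ (seg A.letter w a b).triples ↔ ∃ ρ : ℕ → Q, ρ a = p ∧ ρ b = q ∧
      (∀ i, a ≤ i → i < b → A.step (ρ i) (w i) (ρ (i + 1))) ∧
      (f = true ↔ ∃ i, a ≤ i ∧ i < b ∧ ρ i ∈ A.accept) := by
  induction b, hab using Nat.le_induction generalizing q f with
  | base =>
    simp only [seg_self, Profile.mem_one]
    constructor
    · rintro ⟨rfl, rfl⟩
      refine ⟨fun _ => p, rfl, rfl, fun i h1 h2 => by omega, ?_⟩
      simp only [Bool.false_eq_true, false_iff]
      rintro ⟨i, h1, h2, -⟩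
      omega
    · rintro ⟨ρ, rfl, h, -, h'⟩
      refine ⟨h, ?_⟩
      by_contra hf
      obtain ⟨i, h1, h2, -⟩ := h'.1 (by simpa using hf)
      omega
  | succ b hab ih =>
    rw [seg_succ hab, Profile.mem_mul]
    constructor
    · rintro ⟨r, f₁, f₂, h1, ⟨h2, h2'⟩, rfl⟩
      obtain ⟨ρ, rfl, rfl, h3, h4⟩ := ih.1 h1
      have hlt : ∀ i, i ≤ b → Function.update ρ (b + 1) q i = ρ i := fun i hi =>
        Function.update_of_ne (by omega) _ _
      refine ⟨Function.update ρ (b + 1) q, hlt a hab, by simp, fun i hi hi' => ?_, ?_⟩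
      · rw [hlt i (by omega)]
        rcases Nat.lt_succ_iff_lt_or_eq.1 hi' with h | rfl
        · rw [hlt (i + 1) h]
          exact h3 i hi h
        · simpa using h2
      · simp only at h2'
        rw [Bool.or_eq_true, h4, h2']
        constructor
        · rintro (⟨i, h5, h6, h7⟩ | h5)
          · exact ⟨i, h5, by omega, by rwa [hlt i (by omega)]⟩
          · exact ⟨b, hab, b.lt_succ_self, by rwa [hlt b le_rfl]⟩
        · rintro ⟨i, h5, h6, h7⟩
          rw [hlt i (by omega)] at h7
          rcases Nat.lt_succ_iff_lt_or_eq.1 h6 with h | rfl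
          · exact Or.inl ⟨i, h5, h, h7⟩
          · exact Or.inr h7
    · rintro ⟨ρ, rfl, rfl, h3, h4⟩
      classical
      refine ⟨ρ b, decide (∃ i, a ≤ i ∧ i < b ∧ ρ i ∈ A.accept), decide (ρ b ∈ A.accept),
        ih.2 ⟨ρ, rfl, rfl, fun i h1 h2 => h3 i h1 (by omega), by simp⟩,
        ⟨h3 b hab b.lt_succ_self, by simp⟩, ?_⟩
      rw [Bool.eq_iff_iff, h4, Bool.or_eq_true, decide_eq_true_iff, decide_eq_true_iff]
      constructor
      · rintro ⟨i, h5, h6, h7⟩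
        rcases Nat.lt_succ_iff_lt_or_eq.1 h6 with h | rfl
        · exact Or.inl ⟨i, h5, h, h7⟩
        · exact Or.inr h7
      · rintro (⟨i, h5, h6, h7⟩ | h5)
        · exact ⟨i, h5, by omega, h7⟩
        · exact ⟨b, hab, b.lt_succ_self, h5⟩

/-- Blocks are finite, so infinitely many accepting visits means infinitely many blocks with flag
`true`. Conversely, the paths through the blocks agree at the cuts and can be glued. -/
theorem accepts_iff_blocks {h : ℕ → ℕ} (hh : StrictMono h) (h0 : h 0 = 0) :
    A.Accepts w ↔ ∃ (r : ℕ → Q) (f : ℕ → Bool), r 0 ∈ A.start ∧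
      (∀ n, (r n, f n, r (n + 1)) ∈ (seg A.letter w (h n) (h (n + 1))).triples) ∧
      ∃ᶠ n in atTop, f n = true := by
  have hle : ∀ n, h n ≤ h (n + 1) := fun n => (hh n.lt_succ_self).le
  constructor
  · rintro ⟨ρ, h1, h2, h3⟩
    classical
    refine ⟨fun n => ρ (h n), fun n => decide (∃ i, h n ≤ i ∧ i < h (n + 1) ∧ ρ i ∈ A.accept),
      by simpa only [h0] using h1, fun n => (mem_seg (hle n)).2
        ⟨ρ, rfl, rfl, fun i _ _ => h2 i, by simp⟩, ?_⟩
    rw [frequently_atTop] at h3 ⊢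
    intro N
    obtain ⟨i, hi, hi'⟩ := h3 (h N)
    exact ⟨blockIndex h i, le_blockIndex hh hi, decide_eq_true
      ⟨i, blockIndex_le h0 i, lt_blockIndex_succ hh i, hi'⟩⟩
  · rintro ⟨r, f, h1, h2, h3⟩
    choose ρ hρ using fun n => (mem_seg (hle n)).1 (h2 n)
    have hidx : ∀ {n i}, h n ≤ i → i < h (n + 1) → blockIndex h i = n :=
      fun h1 h2 => blockIndex_eq hh h0 h1 h2
    refine ⟨fun i => ρ (blockIndex h i) i, ?_, fun i => ?_, ?_⟩
    · have : blockIndex h 0 = 0 := hidx h0.le (h0.symm.trans_lt (hh Nat.zero_lt_one))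
      simp only [this]
      have := (hρ 0).1
      rw [h0] at this
      rwa [this]
    · have e1 := blockIndex_le h0 i
      have e2 := lt_blockIndex_succ hh i
      have e3 := (hρ (blockIndex h i)).2.2.1 i e1 e2
      rcases (Nat.succ_le_of_lt e2).lt_or_eq with h5 | h5
      · simp only [hidx (e1.trans i.le_succ) h5]
        exact e3
      · have h5 : i + 1 = h (blockIndex h i + 1) := h5
        have h6 : blockIndex h (i + 1) = blockIndex h i + 1 :=
          hidx h5.ge (by rw [h5]; exact hh (Nat.lt_succ_self _))
        simp only [h6]
        have h7 := (hρ (blockIndex h i)).2.1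
        have h8 := (hρ (blockIndex h i + 1)).1
        rw [← h5] at h7 h8
        rwa [h8, ← h7]
    · rw [frequently_atTop] at h3 ⊢
      intro N
      obtain ⟨n, hn, hn'⟩ := h3 N
      obtain ⟨i, h5, h6, h7⟩ := (hρ n).2.2.2.1 hn'
      refine ⟨i, (hn.trans (hh.id_le n)).trans h5, ?_⟩
      simpa only [hidx h5 h6] using h7

/-- Only the states in `K` occur in transitions. -/
def StatesIn (A : NBA α Q) (K : Set Q) : Prop := ∀ ⦃p a q⦄, A.step p a q → p ∈ K ∧ q ∈ K

/-- Some state `r` recurs at infinitely many cuts of an accepting run. The stretch between two of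
its occurrences that enclose an accepting visit has value `e` by idempotence, and everything before
has value `s` by absorption. -/
theorem accepts_iff_of_isFactorization {K : Set Q} (hK : K.Finite) (hA : A.StatesIn K) {h : ℕ → ℕ}
    {s e : Profile Q} (H : IsFactorization A.letter w h s e) :
    A.Accepts w ↔ ∃ i ∈ A.start, ∃ f r, (i, f, r) ∈ s.triples ∧ (r, true, r) ∈ e.triples := by
  rw [accepts_iff_blocks H.strictMono H.zero]
  constructor
  · rintro ⟨r, f, h1, h2, h3⟩
    have hseg : ∀ n, 1 ≤ n → (r n, f n, r (n + 1)) ∈ e.triples := fun n hn =>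
      H.other n hn ▸ h2 n
    have hs : ∀ n, 1 ≤ n → ∃ g, (r 0, g, r n) ∈ s.triples := fun n hn => by
      induction n, hn using Nat.le_induction with
      | base => exact ⟨f 0, by simpa only [H.zero, H.first] using h2 0⟩
      | succ n hn ih =>
        obtain ⟨g, hg⟩ := ih
        rw [← H.absorb]
        exact ⟨_, _, _, _, hg, hseg n hn, rfl⟩
    have he : ∀ m n, 1 ≤ m → m < n → ∃ g, (r m, g, r n) ∈ e.triples ∧
        ((∃ l, m ≤ l ∧ l < n ∧ f l = true) → g = true) := fun m n hm hn => by
      induction n, hn using Nat.le_induction with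
      | base =>
        refine ⟨f m, hseg m hm, ?_⟩
        rintro ⟨l, h4, h5, h6⟩
        obtain rfl : l = m := by omega
        exact h6
      | succ n hn ih =>
        obtain ⟨g, hg, hg'⟩ := ih
        refine ⟨g || f n, ?_, ?_⟩
        · rw [← H.idem]
          exact ⟨_, _, _, hg, hseg n (by omega), rfl⟩
        · rintro ⟨l, h4, h5, h6⟩
          rcases Nat.lt_succ_iff_lt_or_eq.1 h5 with h | rfl
          · simp [hg' ⟨l, h4, h, h6⟩]
          · simp [h6]
    have hfin : ∀ n, r n ∈ K := fun n => by
      obtain ⟨ρ, h4, -, h5, -⟩ := (mem_seg (H.strictMono n.lt_succ_self).le).1 (h2 n)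
      exact h4 ▸ (hA (h5 _ le_rfl (H.strictMono n.lt_succ_self))).1
    obtain ⟨q, hq⟩ : ∃ q, ∃ᶠ n in atTop, r n = q := by
      by_contra! hc
      have := (eventually_all_finite hK (l := atTop) (p := fun q n => ¬ r n = q)).2 fun q _ => hc q
      obtain ⟨n, hn⟩ := this.exists
      exact hn _ (hfin n) rfl
    rw [frequently_atTop] at h3 hq
    obtain ⟨n, hn, rfl⟩ := hq 1
    obtain ⟨m, hm, hm'⟩ := h3 n
    obtain ⟨l, hl, hl'⟩ := hq (m + 1)
    obtain ⟨g, hg⟩ := hs n hn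
    obtain ⟨g', hg1, hg2⟩ := he n l hn (by omega)
    refine ⟨_, h1, g, r n, hg, ?_⟩
    rw [hg2 ⟨m, hm, by omega, hm'⟩, hl'] at hg1
    exact hg1
  · rintro ⟨i, hi, f, r, h1, h2⟩
    refine ⟨fun n => if n = 0 then i else r, fun n => if n = 0 then f else true, by simpa,
      fun n => ?_, ?_⟩
    · rcases n with _ | n
      · simpa [H.zero, H.first] using h1
      · simpa [H.other] using h2
    · refine Eventually.frequently ?_
      filter_upwards [eventually_gt_atTop 0] with n hn
      simp [Nat.ne_of_gt hn]

end NBA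

/-- Membership in `L` depends only on the `φ`-values of the blocks of a word. -/
def Saturates {α M : Type*} [Monoid M] (φ : α → M) (L : Set (ℕ → α)) : Prop :=
  ∀ ⦃w w' : ℕ → α⦄ ⦃h h' : ℕ → ℕ⦄, StrictMono h → StrictMono h' → h 0 = 0 → h' 0 = 0 →
    (∀ n, seg φ w (h n) (h (n + 1)) = seg φ w' (h' n) (h' (n + 1))) → (w ∈ L ↔ w' ∈ L)

theorem NBA.saturates {α Q : Type*} (A : NBA α Q) : Saturates A.letter {w | A.Accepts w} := by
  intro w w' h h' hh hh' h0 h0' H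
  change A.Accepts w ↔ A.Accepts w'
  rw [accepts_iff_blocks hh h0, accepts_iff_blocks hh' h0']
  simp only [H]

/-! ### Countably many classes are met by finitely many equal-ends classes -/

section mixing

variable {S M : Type*} [Monoid M]

/-- The word that agrees with `x₁` on the blocks selected by `b`, and with `x₀` on the others. -/
def mix (x₀ x₁ : ℕ → S) (h : ℕ → ℕ) (b : ℕ → Bool) : ℕ → S :=
  fun i => bif b (blockIndex h i) then x₁ i else x₀ i

/-- Every second position is `true`. -/
def alternating : ℕ → Bool := fun n => decide (n % 2 = 1)

/-- The cut points are the ends of the maximal constant stretches of `c`, all finite because both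
values recur. -/
theorem exists_runs (c : ℕ → Bool) (h0 : c 0 = false) (hf : ∃ᶠ n in atTop, c n = false)
    (ht : ∃ᶠ n in atTop, c n = true) :
    ∃ k : ℕ → ℕ, StrictMono k ∧ k 0 = 0 ∧
      ∀ n i, k n ≤ i → i < k (n + 1) → c i = alternating n := by
  have next : ∀ m, ∃ l, m < l ∧ c l = !c m ∧ ∀ i, m ≤ i → i < l → c i = c m := by
    intro m
    have hex : ∃ l, m < l ∧ c l = !c m := by
      rw [frequently_atTop] at hf ht
      cases hm : c m
      · obtain ⟨l, hl, hl'⟩ := ht (m + 1)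
        exact ⟨l, hl, hl'⟩
      · obtain ⟨l, hl, hl'⟩ := hf (m + 1)
        exact ⟨l, hl, hl'⟩
    classical
    refine ⟨Nat.find hex, (Nat.find_spec hex).1, (Nat.find_spec hex).2, fun i h1 h2 => ?_⟩
    rcases h1.eq_or_lt with rfl | h1
    · rfl
    · have := Nat.find_min hex h2
      simp only [not_and, h1, true_implies] at this
      cases hi : c i <;> cases hm : c m <;> simp_all
  choose g hg1 hg2 hg3 using next
  have hc : ∀ n, c (g^[n] 0) = alternating n := fun n => by
    induction n with
    | zero => simpa [alternating] using h0
    | succ n ih =>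
      rw [Function.iterate_succ_apply', hg2, ih, alternating, alternating, ← decide_not]
      congr 1
      simp only [eq_iff_iff]
      omega
  refine ⟨fun n => g^[n] 0, strictMono_nat_of_lt_succ fun n => ?_, rfl, fun n i h1 h2 => ?_⟩
  · simp only [Function.iterate_succ_apply']
    exact hg1 _
  · simp only [Function.iterate_succ_apply'] at h2
    rw [hg3 _ _ h1 h2, hc]

variable {φ : S × S → M} {x₀ x₁ : ℕ → S} {h : ℕ → ℕ} {s e f : M}

theorem seg_mix (hh : StrictMono h) (h0 : h 0 = 0) (b b' : ℕ → Bool) (n : ℕ) :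
    seg φ (convolution (mix x₀ x₁ h b) (mix x₀ x₁ h b')) (h n) (h (n + 1)) =
      seg φ (convolution (bif b n then x₁ else x₀) (bif b' n then x₁ else x₀))
        (h n) (h (n + 1)) := by
  refine seg_congr fun i h1 h2 => ?_
  simp only [convolution, mix, blockIndex_eq hh h0 h1 h2]
  cases b n <;> cases b' n <;> rfl

/-- Two mixed words, the first below the second, which both agree and differ on infinitely many
blocks: whether they are related does not depend on the choice of blocks. -/
theorem mix_mem_iff {L : Set (ℕ → S × S)} (hL : Saturates φ L)
    (h00 : IsFactorization φ (convolution x₀ x₀) h s e)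
    (h11 : ∀ n, 1 ≤ n → seg φ (convolution x₁ x₁) (h n) (h (n + 1)) = e)
    (h01 : ∀ n, 1 ≤ n → seg φ (convolution x₀ x₁) (h n) (h (n + 1)) = f) (hf : f * f = f)
    {b b' : ℕ → Bool} (hb : b' 0 = false) (hbb : ∀ n, b n = true → b' n = true)
    (heq : ∃ᶠ n in atTop, b n = b' n) (hne : ∃ᶠ n in atTop, b n ≠ b' n) :
    convolution (mix x₀ x₁ h b) (mix x₀ x₁ h b') ∈ L ↔
      convolution x₀ (mix x₀ x₁ h alternating) ∈ L := by
  obtain ⟨hh, h0, hs, -, he, hse⟩ := id h00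
  have b0 : b 0 = false := by
    by_contra hc
    simp [hbb 0 (by simpa using hc)] at hb
  have value : ∀ (b b' : ℕ → Bool), b 0 = false → b' 0 = false →
      (∀ n, b n = true → b' n = true) → ∀ n,
      seg φ (convolution (mix x₀ x₁ h b) (mix x₀ x₁ h b')) (h n) (h (n + 1)) =
        if n = 0 then s else if b n = b' n then e else f := by
    intro b b' hb0 hb1 hbb n
    rw [seg_mix hh h0]
    split_ifs with h1 h2
    · subst h1
      rw [hb0, hb1, h0]
      exact hs
    · rw [← h2]
      cases b n
      · exact h00.other n (by omega)
      · exact h11 n (by omega)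
    · cases h3 : b n
      · have : b' n = true := by
          rw [h3] at h2
          exact (Bool.eq_false_or_eq_true _).resolve_right (Ne.symm h2)
        rw [this]
        exact h01 n (by omega)
      -- This is what `hbb` is for: blocks pairing `x₁` with `x₀` in this order have no prescribed
      -- value, and they do not occur.
      · exact absurd (h3.trans (hbb n h3).symm) h2
  obtain ⟨k, hk, hk0, hkc⟩ := exists_runs (fun n => decide (b n ≠ b' n)) (by simp [b0, hb])
    (by simpa using heq) (by simpa using hne)
  have hx : x₀ = mix x₀ x₁ h fun _ => false := by
    funext i; simp [mix]
  conv_rhs => rw [show convolution x₀ (mix x₀ x₁ h alternating) =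
    convolution (mix x₀ x₁ h fun _ => false) (mix x₀ x₁ h alternating) by rw [← hx]]
  -- Merging each run of agreeing or differing blocks into one block gives the values `s, f, e, f,
  -- e, …` by idempotence, exactly those of the right-hand pair under the cuts `h`.
  refine hL (hh.comp hk) hh (by simp [hk0, h0]) h0 fun n => ?_
  rw [value (fun _ => false) alternating rfl rfl (by simp)]
  simp only [Function.comp_apply]
  have hkn : k n < k (n + 1) := hk n.lt_succ_self
  rcases Nat.eq_zero_or_pos n with rfl | hn
  · rw [if_pos rfl, hk0, ← seg_mul (hh.monotone (zero_le_one)) (hh.monotone (by omega)),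
      show seg φ _ (h 0) (h 1) = s from (value b b' b0 hb hbb 0).trans (if_pos rfl)]
    rcases (show 1 ≤ k (0 + 1) by omega).eq_or_lt with h1 | h1
    · simp [← h1]
    · rw [seg_eq_of_idempotent hh.monotone he h1 fun i h2 h3 => ?_, hse]
      have := hkc 0 i (by omega) h3
      rw [value b b' b0 hb hbb, if_neg (by omega), if_pos]
      simpa [alternating] using this
  · have hk1 : n ≤ k n := hk.id_le n
    rw [if_neg (by omega)]
    cases h1 : alternating n
    · rw [if_pos rfl]
      refine seg_eq_of_idempotent hh.monotone he hkn fun i h2 h3 => ?_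
      have := hkc n i h2 h3
      rw [value b b' b0 hb hbb, if_neg (by omega), if_pos]
      simpa [h1] using this
    · rw [if_neg (by simp)]
      refine seg_eq_of_idempotent hh.monotone hf hkn fun i h2 h3 => ?_
      have := hkc n i h2 h3
      rw [value b b' b0 hb hbb, if_neg (by omega), if_neg]
      simpa [h1] using this

end mixing

/-- Uncountably many sets of block indices, any two of them comparable by inclusion and differing
at infinitely many places. -/
theorem exists_chain : ∃ c : ℝ → ℕ → Bool, (∀ t, c t 0 = false) ∧ ∀ t t', t < t' →
    (∀ n, c t n = true → c t' n = true) ∧ (∃ᶠ n in atTop, c t n = c t' n) ∧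
      ∃ᶠ n in atTop, c t n ≠ c t' n := by
  classical
  let q : ℕ ≃ ℚ := (Denumerable.eqv ℚ).symm
  have hq : ∀ a b : ℝ, a < b → ∃ᶠ n in atTop, n ≠ 0 ∧ a < (q n : ℝ) ∧ (q n : ℝ) < b := by
    intro a b hab
    have hinf : {r : ℚ | a < (r : ℝ) ∧ (r : ℝ) < b}.Infinite := by
      obtain ⟨r, h1, h2⟩ := exists_rat_btwn hab
      obtain ⟨r', h3, h4⟩ := exists_rat_btwn h2
      refine (Set.Ioo_infinite (show r < r' by exact_mod_cast h3)).mono fun x hx => ?_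
      exact ⟨h1.trans (by exact_mod_cast hx.1), lt_trans (by exact_mod_cast hx.2) h4⟩
    have h1 : ∃ᶠ n in atTop, a < (q n : ℝ) ∧ (q n : ℝ) < b := by
      rw [← Nat.cofinite_eq_atTop, frequently_cofinite_iff_infinite]
      have := hinf.preimage (f := q) fun x _ => q.surjective.range_eq ▸ Set.mem_univ x
      exact this
    refine (h1.and_eventually (eventually_ne_atTop 0)).mono fun n hn => ⟨hn.2, hn.1⟩
  -- Dedekind cuts in an enumeration of `ℚ`. Index `0` is never selected, since the first block must
  -- stay unmixed.
  refine ⟨fun t n => decide (n ≠ 0 ∧ (q n : ℝ) < t), fun t => by simp, fun t t' htt =>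
    ⟨fun n => ?_, ?_, ?_⟩⟩
  · simp only [decide_eq_true_eq]
    exact fun hn => ⟨hn.1, hn.2.trans htt⟩
  · refine (hq (t - 1) t (by linarith)).mono fun n hn => ?_
    simp [hn.1, hn.2.2, hn.2.2.trans htt]
  · refine (hq t t' htt).mono fun n hn => ?_
    simp [hn.1, hn.2.2, hn.2.1.le]

theorem exists_finite_meeting_of_countable {S M : Type*} [Monoid M] [Finite M] {φ : S × S → M}
    {D : Set (ℕ → S)} {r : (ℕ → S) → (ℕ → S) → Prop} (hr : IsEquivalenceOn D r)
    (hL : Saturates φ {w | r (fun n => (w n).1) fun n => (w n).2})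
    (hc : (classesOn D r).Countable) :
    ∃ s : Finset (ℕ → S), ∀ x ∈ D, ∃ y, r x y ∧ ∃ z ∈ s, ∀ᶠ n in atTop, y n = z n := by
  -- For `i < j`, no word in the class of `X j` will have the ends of `X i`. This asymmetry makes
  -- the later word `X j` the base of the mixtures.
  by_contra! hcon
  obtain ⟨X, hX, hX'⟩ := exists_seq_of_forall_finset_exists (fun x => x ∈ D)
    (fun x y => ∀ z, r y z → ¬ ∀ᶠ n in atTop, z n = x n) (fun s _ => by
      obtain ⟨x, hx, hx'⟩ := hcon s
      exact ⟨x, hx, fun y hy z hz hyz => hx' z hz y hy (hyz.mono fun _ => not_not.2)⟩)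
  have := Fintype.ofFinite M
  let N := Fintype.card M + 1
  -- The colour is the whole matrix of pair values, so the same cuts serve all pairs.
  obtain ⟨H, E, hH, hE⟩ := exists_strictMono_homogeneous (κ := Fin N → Fin N → M)
    fun a b i j => seg φ (convolution (X i) (X j)) a b
  obtain ⟨i, j, hij, hijE⟩ : ∃ i j : Fin N, i < j ∧ E i i = E j j := by
    obtain ⟨i, j, hij, h⟩ := Fintype.exists_ne_map_eq_of_card_lt (fun i : Fin N => E i i)
      (by simp [N])
    rcases hij.lt_or_gt with h1 | h1
    exacts [⟨i, j, h1, h⟩, ⟨j, i, h1, h.symm⟩]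
  have hval : ∀ (i j : Fin N) a b, a < b →
      seg φ (convolution (X i) (X j)) (H a) (H b) = E i j := fun i j a b hab =>
    congr_fun (congr_fun (hE a b hab) i) j
  have hidem : ∀ i j : Fin N, E i j * E i j = E i j := fun i j => by
    have := seg_mul (φ := φ) (w := convolution (X i) (X j))
      (hH (Nat.lt_succ_self 0)).le (hH (Nat.lt_succ_self 1)).le
    rwa [hval i j 0 1 (by omega), hval i j 1 2 (by omega), hval i j 0 2 (by omega)] at this
  let h : ℕ → ℕ := fun n => if n = 0 then 0 else H n
  have h0 : h 0 = 0 := rfl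
  have hn : ∀ n, 1 ≤ n → h n = H n := fun n hn => if_neg (by omega)
  have hh : StrictMono h := strictMono_nat_of_lt_succ fun n => by
    rw [hn (n + 1) (by omega)]
    rcases Nat.eq_zero_or_pos n with rfl | h1
    · exact (Nat.zero_le _).trans_lt (hH Nat.zero_lt_one)
    · rw [hn n h1]
      exact hH n.lt_succ_self
  have hval' : ∀ (i j : Fin N) n, 1 ≤ n →
      seg φ (convolution (X i) (X j)) (h n) (h (n + 1)) = E i j := fun i j n h1 => by
    rw [hn n h1, hn (n + 1) (by omega), hval i j _ _ n.lt_succ_self]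
  have h00 : IsFactorization φ (convolution (X j) (X j)) h
      (seg φ (convolution (X j) (X j)) 0 (h 1)) (E i i) :=
    ⟨hh, h0, rfl, fun n h1 => by rw [hval' j j n h1, hijE], hidem i i, by
      rw [hn 1 le_rfl, ← seg_mul (Nat.zero_le _) (hH Nat.zero_lt_one).le,
        hval j j 0 1 Nat.zero_lt_one, mul_assoc, hijE, hidem j j]⟩
  let Z := mix (X j) (X i) h
  have key : ∀ b b' : ℕ → Bool, b' 0 = false → (∀ n, b n = true → b' n = true) →
      (∃ᶠ n in atTop, b n = b' n) → (∃ᶠ n in atTop, b n ≠ b' n) →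
      (r (Z b) (Z b') ↔ r (X j) (Z alternating)) := fun b b' h1 h2 h3 h4 =>
    mix_mem_iff hL h00 (hval' i i) (hval' j i) (hidem j i) h1 h2 h3 h4
  have odd_even : ∀ N, ∃ m, N ≤ m ∧ m ≠ 0 ∧ alternating m = true ∧
      alternating (m + 1) = false := fun N =>
    ⟨2 * N + 1, by omega, by omega, decide_eq_true (by omega), decide_eq_false (by omega)⟩
  have notrel : ¬ r (X j) (Z alternating) := by
    intro hrel
    -- `Z b'` equals `X i` from the first cut on, so relating it to `X j` is forbidden.
    let b' : ℕ → Bool := fun n => decide (n ≠ 0)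
    have h1 : r (Z alternating) (Z b') := by
      refine (key _ _ rfl (fun n hn => ?_) ?_ ?_).2 hrel
      · refine decide_eq_true ?_
        rintro rfl
        simp [alternating] at hn
      · rw [frequently_atTop]
        intro N
        obtain ⟨m, h1, h2, h3, -⟩ := odd_even N
        exact ⟨m, h1, by rw [h3]; exact (decide_eq_true h2).symm⟩
      · rw [frequently_atTop]
        intro N
        obtain ⟨m, h1, h2, -, h3⟩ := odd_even N
        exact ⟨m + 1, by omega, by rw [h3]; simp [b']⟩
    refine hX' i j hij _ (hr.trans hrel h1) ?_
    filter_upwards [eventually_ge_atTop (h 1)] with n hn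
    have := le_blockIndex hh hn
    simp [Z, mix, b', Nat.one_le_iff_ne_zero.1 this]
  obtain ⟨c, hc0, hc'⟩ := exists_chain
  have hD : ∀ t, Z (c t) ∈ D := fun t => by
    have : r (Z (c t)) (Z (c t)) := by
      refine (hL (w := convolution (X j) (X j)) (w' := convolution (Z (c t)) (Z (c t)))
        hh hh h0 h0 fun n => ?_).1 (hr.refl (hX j))
      rw [seg_mix hh h0]
      rcases Nat.eq_zero_or_pos n with rfl | hn
      · simp [hc0]
      · cases c t n
        · rfl
        · exact (hval' j j n hn).trans (hijE.symm.trans (hval' i i n hn).symm)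
    exact (hr.mem this).1
  have hneq : ∀ t t', t < t' → ¬ r (Z (c t)) (Z (c t')) := fun t t' htt h1 => by
    obtain ⟨h2, h3, h4⟩ := hc' t t' htt
    exact notrel ((key _ _ (hc0 t') h2 h3 h4).1 h1)
  have hinj : Function.Injective fun t : ℝ =>
      (⟨{y | r (Z (c t)) y}, _, hD t, rfl⟩ : classesOn D r) := fun t t' htt => by
    have h1 : {y | r (Z (c t)) y} = {y | r (Z (c t')) y} := congr_arg Subtype.val htt
    have h2 : r (Z (c t')) (Z (c t)) := h1.subset (hr.refl (hD t))
    rcases lt_trichotomy t t' with h | h | h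
    exacts [(hneq _ _ h (hr.symm h2)).elim, h, (hneq _ _ h h2).elim]
  have := hc.to_subtype
  exact not_countable (α := ℝ) hinj.countable

/-! ### Closure properties of ω-regular languages -/

/-- The language is accepted by a Büchi automaton with finitely many states. -/
def Reg {α : Type*} (L : Set (ℕ → α)) : Prop :=
  ∃ (Q : Type) (_ : Finite Q) (A : NBA α Q), ∀ w, w ∈ L ↔ A.Accepts w

namespace BuchiAutomaton

variable {α β : Type*}

/-- Every state of an infinite run is the source of a transition, so the finitely many sources
suffice as states. -/
theorem reg (A : BuchiAutomaton α) : Reg {w | A.Accepts w} := by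
  refine ⟨{p // p ∈ A.transitions.map Prod.fst}, inferInstance,
    ⟨{p | p.1 ∈ A.initial}, fun p a q => (p.1, a, q.1) ∈ A.transitions,
      {p | p.1 ∈ A.accepting}⟩, fun w => ?_⟩
  constructor
  · rintro ⟨ρ, ⟨h1, h2⟩, h3⟩
    exact ⟨fun i => ⟨ρ i, List.mem_map_of_mem (h2 i)⟩, h1, h2, h3⟩
  · rintro ⟨ρ, h1, h2, h3⟩
    exact ⟨fun i => ρ i, ⟨h1, h2⟩, h3⟩

/-- Apply a function to the letters of the transitions. -/
def mapLetters (g : α → β) (A : BuchiAutomaton α) : BuchiAutomaton β :=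
  ⟨A.initial, A.transitions.map fun t => (t.1, g t.2.1, t.2.2), A.accepting⟩

theorem mapLetters_accepts {g : α → β} {A : BuchiAutomaton α} {w : ℕ → β} :
    (A.mapLetters g).Accepts w ↔ ∃ w', (∀ n, g (w' n) = w n) ∧ A.Accepts w' := by
  constructor
  · rintro ⟨ρ, ⟨h1, h2⟩, h3⟩
    have : ∀ i, ∃ a, (ρ i, a, ρ (i + 1)) ∈ A.transitions ∧ g a = w i := fun i => by
      obtain ⟨⟨p, a, q⟩, h4, h5⟩ := List.mem_map.1 (h2 i)
      simp only [Prod.mk.injEq] at h5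
      obtain ⟨rfl, h5, rfl⟩ := h5
      exact ⟨a, h4, h5⟩
    choose w' hw hw' using this
    exact ⟨w', hw', ρ, ⟨h1, hw⟩, h3⟩
  · rintro ⟨w', hw, ρ, ⟨h1, h2⟩, h3⟩
    exact ⟨ρ, ⟨h1, fun i => List.mem_map.2 ⟨_, h2 i, by simp [hw]⟩⟩, h3⟩

end BuchiAutomaton

namespace Reg

variable {α β : Type*} {L L' : Set (ℕ → α)}

theorem isOmegaRegular [Finite α] (hL : Reg L) : IsOmegaRegular L := by
  obtain ⟨Q, _, A, hA⟩ := hL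
  obtain ⟨n, ⟨e⟩⟩ := Finite.exists_equiv_fin Q
  let c : Q → ℕ := fun q => e q
  have hc : Function.Injective c := fun p q h => e.injective (Fin.ext h)
  let I : Set ℕ := c '' A.start
  let T : Set (ℕ × α × ℕ) := {t | ∃ p q, A.step p t.2.1 q ∧ t.1 = c p ∧ t.2.2 = c q}
  let F : Set ℕ := c '' A.accept
  have hT : T.Finite := by
    refine (Set.finite_range fun t : Q × α × Q => (c t.1, t.2.1, c t.2.2)).subset ?_
    rintro ⟨_, a, _⟩ ⟨p, q, h, rfl, rfl⟩
    exact ⟨(p, a, q), rfl⟩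
  have hI : I.Finite := (Set.toFinite _).image _
  have hF : F.Finite := (Set.toFinite _).image _
  refine ⟨⟨hI.toFinset.toList, hT.toFinset.toList, hF.toFinset.toList⟩, fun w => ?_⟩
  rw [hA]
  constructor
  · rintro ⟨ρ, h1, h2, h3⟩
    refine ⟨fun i => c (ρ i), ⟨?_, fun i => ?_⟩, h3.mono fun i hi => ?_⟩
    · simpa using show c (ρ 0) ∈ I from Set.mem_image_of_mem c h1
    · simpa using show _ ∈ T from ⟨ρ i, ρ (i + 1), h2 i, rfl, rfl⟩
    · simpa using show c (ρ i) ∈ F from Set.mem_image_of_mem c hi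
  · rintro ⟨ρ, ⟨h1, h2⟩, h3⟩
    simp only [Finset.mem_toList, Set.Finite.mem_toFinset] at h1 h2 h3
    have : ∀ i, ∃ q, c q = ρ i := fun i => by
      obtain ⟨p, q, h4, h5, h6⟩ := h2 i
      exact ⟨p, h5.symm⟩
    choose ρ' hρ' using this
    refine ⟨ρ', ?_, fun i => ?_, h3.mono fun i hi => ?_⟩
    · rwa [← hρ' 0, hc.mem_set_image] at h1
    · obtain ⟨p, q, h4, h5, h6⟩ := h2 i
      rw [hc ((hρ' i).trans h5), hc ((hρ' (i + 1)).trans h6)]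
      exact h4
    · rwa [← hρ' i, hc.mem_set_image] at hi

theorem comap (hL : Reg L) (g : β → α) : Reg {w : ℕ → β | (fun i => g (w i)) ∈ L} := by
  obtain ⟨Q, hQ, A, hA⟩ := hL
  exact ⟨Q, hQ, ⟨A.start, fun p b q => A.step p (g b) q, A.accept⟩, fun w => hA _⟩

/-- Projection to the first track. -/
theorem proj {L : Set (ℕ → α × β)} (hL : Reg L) : Reg {x : ℕ → α | ∃ y, convolution x y ∈ L} := by
  obtain ⟨Q, hQ, A, hA⟩ := hL
  refine ⟨Q, hQ, ⟨A.start, fun p a q => ∃ b, A.step p (a, b) q, A.accept⟩, fun w => ?_⟩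
  constructor
  · rintro ⟨y, hy⟩
    obtain ⟨ρ, h1, h2, h3⟩ := (hA _).1 hy
    exact ⟨ρ, h1, fun i => ⟨y i, h2 i⟩, h3⟩
  · rintro ⟨ρ, h1, h2, h3⟩
    choose y hy using h2
    exact ⟨y, (hA _).2 ⟨ρ, h1, hy, h3⟩⟩

theorem iUnion {ι : Type} [Finite ι] {L : ι → Set (ℕ → α)} (hL : ∀ i, Reg (L i)) :
    Reg (⋃ i, L i) := by
  choose Q hQ A hA using hL
  refine ⟨Σ i, Q i, inferInstance, ⟨{p | p.2 ∈ (A p.1).start},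
    fun p a q => ∃ (i : ι) (p' q' : Q i), (A i).step p' a q' ∧ p = ⟨i, p'⟩ ∧ q = ⟨i, q'⟩,
    {p | p.2 ∈ (A p.1).accept}⟩, fun w => ?_⟩
  rw [Set.mem_iUnion]
  constructor
  · rintro ⟨i, hi⟩
    obtain ⟨ρ, h1, h2, h3⟩ := (hA i w).1 hi
    exact ⟨fun n => ⟨i, ρ n⟩, h1, fun n => ⟨i, _, _, h2 n, rfl, rfl⟩, h3⟩
  · rintro ⟨ρ, h1, h2, h3⟩
    have hfst : ∀ n, ∃ q, ρ n = ⟨(ρ 0).1, q⟩ := fun n => by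
      induction n with
      | zero => exact ⟨_, rfl⟩
      | succ n ih =>
        obtain ⟨q, hq⟩ := ih
        obtain ⟨i, p', q', -, h5, h6⟩ := h2 n
        obtain rfl : i = (ρ 0).1 := congr_arg Sigma.fst (h5.symm.trans hq)
        exact ⟨q', h6⟩
    choose ρ' hρ' using hfst
    refine ⟨(ρ 0).1, (hA _ w).2 ⟨ρ', ?_, fun n => ?_, h3.mono fun n hn => ?_⟩⟩
    · have h1 : (ρ 0).2 ∈ (A (ρ 0).1).start := h1
      rw [hρ' 0] at h1
      exact h1
    · obtain ⟨i, p', q', h4, h5, h6⟩ := h2 n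
      obtain rfl : i = (ρ 0).1 := congr_arg Sigma.fst (h5.symm.trans (hρ' n))
      rw [hρ' n] at h5
      rw [hρ' (n + 1)] at h6
      rw [eq_of_heq (Sigma.mk.inj h5).2, eq_of_heq (Sigma.mk.inj h6).2]
      exact h4
    · have hn : (ρ n).2 ∈ (A (ρ n).1).accept := hn
      rw [hρ' n] at hn
      exact hn

theorem union (hL : Reg L) (hL' : Reg L') : Reg (L ∪ L') := by
  rw [Set.union_eq_iUnion]
  exact iUnion fun b => by cases b <;> assumption

theorem empty : Reg (∅ : Set (ℕ → α)) := by
  have := iUnion (α := α) (L := fun i : Empty => i.elim) fun i => i.elim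
  simpa using this

/-- The words that have a factorization with values `s` and `e`. -/
theorem setOf_isFactorization {M : Type} [Monoid M] [Finite M] (φ : α → M) (s e : M) :
    Reg {w | ∃ h, IsFactorization φ w h s e} := by
  by_cases hse : e * e = e ∧ s * e = s
  swap
  · convert empty using 1
    refine Set.eq_empty_of_forall_notMem ?_
    rintro w ⟨h, H⟩
    exact hse ⟨H.idem, H.absorb⟩
  obtain ⟨he, hs⟩ := hse
  let next : Option M → α → M := fun o a => o.elim (φ a) fun t => t * φ a
  -- The automaton guesses the cuts. Its state records whether the first block is complete and the
  -- product since the last cut, with `none` exactly at a cut.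
  refine ⟨Bool × Option M, inferInstance, ⟨{(false, none)}, fun p a q =>
    q = (p.1, some (next p.2 a)) ∨ q = (true, none) ∧ next p.2 a = bif p.1 then e else s,
    {(true, none)}⟩, fun w => ?_⟩
  constructor
  · rintro ⟨h, H⟩
    have hh := H.strictMono
    refine ⟨fun i => (decide (blockIndex h i ≠ 0), if h (blockIndex h i) = i then none else
      some (seg φ w (h (blockIndex h i)) i)), ?_, fun i => ?_, ?_⟩
    · have : blockIndex h 0 = 0 := rfl
      simp [this, H.zero]
    · have e1 := blockIndex_le H.zero i
      have e2 := lt_blockIndex_succ hh i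
      have hnext : next (if h (blockIndex h i) = i then none else
          some (seg φ w (h (blockIndex h i)) i)) (w i) =
            seg φ w (h (blockIndex h i)) (i + 1) := by
        split_ifs with h1
        · rw [h1]
          exact seg_succ_self.symm
        · exact (seg_succ e1).symm
      rcases (Nat.succ_le_of_lt e2).lt_or_eq with h5 | h5
      · left
        have h6 := blockIndex_eq hh H.zero (e1.trans i.le_succ) h5
        simp only [Nat.succ_eq_add_one] at h6
        simp only [hnext, h6]
        rw [if_neg (by omega)]
      · right
        have h5 : i + 1 = h (blockIndex h i + 1) := h5
        have h6 : blockIndex h (i + 1) = blockIndex h i + 1 :=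
          blockIndex_eq hh H.zero h5.ge (by rw [h5]; exact hh (Nat.lt_succ_self _))
        simp only [hnext, h6]
        rw [if_pos h5.symm]
        refine ⟨by simp, ?_⟩
        rw [h5]
        by_cases h7 : blockIndex h i = 0
        · simpa [h7, H.zero] using H.first
        · simpa [h7] using H.other _ (Nat.one_le_iff_ne_zero.2 h7)
    · rw [frequently_atTop]
      refine fun N => ⟨h (N + 1), (N.le_succ).trans (hh.id_le _), ?_⟩
      have h6 : blockIndex h (h (N + 1)) = N + 1 :=
        blockIndex_eq hh H.zero le_rfl (hh (Nat.lt_succ_self _))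
      simp [h6]
  · rintro ⟨ρ, h1, h2, h3⟩
    have h1 : ρ 0 = (false, none) := h1
    have inv0 : ∀ n, (ρ n = (false, none) → n = 0) ∧
        (∀ t, ρ n = (false, some t) → seg φ w 0 n = t) ∧
        (ρ n = (true, none) → seg φ w 0 n = s) ∧
        (∀ t, ρ n = (true, some t) → seg φ w 0 n = s * t) := fun n => by
      induction n with
      | zero => simp [h1]
      | succ n ih =>
        obtain ⟨i1, i2, i3, i4⟩ := ih
        have h4 := h2 n
        rw [seg_succ n.zero_le]
        rcases hρ : ρ n with ⟨_ | _, _ | t⟩ <;> rw [hρ] at h4 i1 i2 i3 i4 <;>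
          rcases h4 with h4 | ⟨h4, h5⟩ <;> rw [h4] <;> simp_all [next, mul_assoc]
    -- Further cuts may lie between `m` and `n`; the blocks they complete multiply to `e`, whence
    -- the alternative `e * t`.
    have inv1 : ∀ m, ρ m = (true, none) → ∀ n, m < n → (ρ n).1 = true ∧
        (ρ n = (true, none) → seg φ w m n = e) ∧
        (∀ t, ρ n = (true, some t) → seg φ w m n = t ∨ seg φ w m n = e * t) := by
      intro m hm n hmn
      induction n, hmn using Nat.le_induction with
      | base =>
        have h4 := h2 m
        rw [hm] at h4
        rcases h4 with h4 | ⟨h4, h5⟩ <;> simp_all [next]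
      | succ n hmn ih =>
        obtain ⟨i1, i2, i3⟩ := ih
        have h4 := h2 n
        rw [seg_succ (Nat.le_of_succ_le hmn)]
        rcases hρ : ρ n with ⟨_ | _, _ | t⟩ <;> rw [hρ] at h4 i1 i2 i3
        · simp at i1
        · simp at i1
        · rw [i2 rfl]
          rcases h4 with h4 | ⟨h4, h5⟩ <;> simp_all [next]
        · rcases i3 t rfl with i3 | i3 <;> rw [i3] <;>
            rcases h4 with h4 | ⟨h4, h5⟩ <;> simp_all [next, mul_assoc]
    obtain ⟨g, hg, hg'⟩ := extraction_of_frequently_atTop h3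
    have hg' : ∀ n, ρ (g n) = (true, none) := hg'
    have hn : ∀ n, 1 ≤ n → (if n = 0 then 0 else g n) = g n := fun n hn => if_neg (by omega)
    refine ⟨fun n => if n = 0 then 0 else g n, strictMono_nat_of_lt_succ fun n => ?_, rfl,
      ?_, fun n h4 => ?_, he, hs⟩
    · rw [hn (n + 1) (by omega)]
      rcases Nat.eq_zero_or_pos n with rfl | h4
      · exact (Nat.zero_le _).trans_lt (hg Nat.zero_lt_one)
      · rw [hn n h4]
        exact hg n.lt_succ_self
    · exact (inv0 _).2.2.1 (hg' 1)
    · rw [hn (n + 1) (by omega), hn n h4]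
      exact (inv1 _ (hg' n) _ (hg n.lt_succ_self)).2.1 (hg' _)

/-- Büchi's complementation: the values of one factorization settle membership, so the complement is
the finite union over the pairs realized by a word outside `L`. -/
theorem _root_.Saturates.reg_compl {M : Type} [Monoid M] [Finite M] {φ : α → M}
    (hL : Saturates φ L) : Reg Lᶜ := by
  let P : Set (M × M) := {p | ∃ w h, IsFactorization φ w h p.1 p.2 ∧ w ∉ L}
  have : Lᶜ = ⋃ p : P, {w | ∃ h, IsFactorization φ w h p.1.1 p.1.2} := by
    ext w
    simp only [Set.mem_compl_iff, Set.mem_iUnion]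
    constructor
    · intro hw
      obtain ⟨h, s, e, H⟩ := exists_isFactorization φ w
      exact ⟨⟨(s, e), w, h, H, hw⟩, h, H⟩
    · rintro ⟨⟨⟨s, e⟩, w', h', H', hw'⟩, h, H⟩
      rwa [hL H.strictMono H'.strictMono H.zero H'.zero fun n => ?_]
      rcases Nat.eq_zero_or_pos n with rfl | hn
      · rw [H.zero, H'.zero]
        exact H.first.trans H'.first.symm
      · exact (H.other n hn).trans (H'.other n hn).symm
  rw [this]
  exact iUnion fun p => setOf_isFactorization φ _ _

theorem exists_saturates (hL : Reg L) :
    ∃ (M : Type) (_ : Monoid M) (_ : Finite M) (φ : α → M), Saturates φ L := by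
  obtain ⟨Q, hQ, A, hA⟩ := hL
  obtain rfl : L = {w | A.Accepts w} := Set.ext hA
  exact ⟨Profile Q, inferInstance, inferInstance, A.letter, A.saturates⟩

theorem compl (hL : Reg L) : Reg Lᶜ := by
  obtain ⟨M, _, _, φ, hφ⟩ := hL.exists_saturates
  exact hφ.reg_compl

theorem inter (hL : Reg L) (hL' : Reg L') : Reg (L ∩ L') := by
  rw [← compl_compl (L ∩ L'), Set.compl_inter]
  exact (hL.compl.union hL'.compl).compl

/-- The words in which a letter from `U` occurs, and only letters from `V` after it. -/
theorem eventually_after (U V : Set α) :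
    Reg {w : ℕ → α | ∃ n, w n ∈ U ∧ ∀ m, n < m → w m ∈ V} := by
  refine ⟨Bool, inferInstance, ⟨{false}, fun p a q =>
    (p = false ∧ q = false) ∨ (p = false ∧ q = true ∧ a ∈ U) ∨ (p = true ∧ q = true ∧ a ∈ V),
    {true}⟩, fun w => ?_⟩
  constructor
  · rintro ⟨n, h1, h2⟩
    refine ⟨fun i => decide (n < i), by simp, fun i => ?_, ?_⟩
    · rcases lt_trichotomy n i with h | rfl | h
      · exact Or.inr (Or.inr ⟨by simpa, by simp; omega, h2 i h⟩)
      · exact Or.inr (Or.inl ⟨by simp, by simp, h1⟩)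
      · exact Or.inl ⟨by simp; omega, by simp; omega⟩
    · refine ((eventually_gt_atTop n).mono fun i hi => ?_).frequently
      simpa using hi
  · rintro ⟨ρ, h1, h2, h3⟩
    have h1 : ρ 0 = false := h1
    classical
    have hex : ∃ n, ρ n = true := h3.exists
    obtain ⟨n, hn⟩ : ∃ n, Nat.find hex = n + 1 := Nat.exists_eq_succ_of_ne_zero fun h => by
      have := Nat.find_spec hex
      rw [h, h1] at this
      simp at this
    have hn1 : ρ (n + 1) = true := hn ▸ Nat.find_spec hex
    have hn0 : ρ n = false := by simpa using Nat.find_min hex (m := n) (by omega)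
    refine ⟨n, by simpa [hn0, hn1] using h2 n, fun m hm => ?_⟩
    have : ρ m = true := by
      induction m, hm using Nat.le_induction with
      | base => exact hn1
      | succ m hm ih => exact (show ρ (m + 1) = true ∧ w m ∈ V by simpa [ih] using h2 m).1
    exact (show ρ (m + 1) = true ∧ w m ∈ V by simpa [this] using h2 m).2

theorem eventually (V : Set α) : Reg {w : ℕ → α | ∀ᶠ n in atTop, w n ∈ V} := by
  convert eventually_after Set.univ V using 1
  ext w
  simp only [Set.mem_ofPred_eq, Set.mem_univ, true_and, eventually_atTop]
  constructor
  · rintro ⟨n, hn⟩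
    exact ⟨n, fun m hm => hn m hm.le⟩
  · rintro ⟨n, hn⟩
    exact ⟨n + 1, fun m hm => hn m hm⟩

theorem singleton_lasso (w : ℕ → α) {a b : ℕ} {g : ℕ → ℕ} (h0 : g 0 = 0)
    (hb : ∀ n, g n < b) (hg : ∀ n, g (n + 1) = if g n + 1 = b then a else g n + 1) :
    Reg {fun n => w (g n)} := by
  refine ⟨Fin b, inferInstance, ⟨{p | p.1 = 0}, fun p c q =>
    c = w p ∧ q.1 = if p.1 + 1 = b then a else p.1 + 1, Set.univ⟩, fun x => ?_⟩
  constructor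
  · rintro rfl
    exact ⟨fun n => ⟨g n, hb n⟩, h0, fun n => ⟨rfl, hg n⟩, 
      (Eventually.of_forall fun _ => Set.mem_univ _).frequently⟩
  · rintro ⟨ρ, h1, h2, -⟩
    have : ∀ n, (ρ n).1 = g n := fun n => by
      induction n with
      | zero => exact Eq.trans h1 h0.symm
      | succ n ih => rw [(h2 n).2, ih, hg]
    funext n
    rw [(h2 n).1, this]

/-- A nonempty ω-regular language has an element which is ω-regular as a singleton. -/
theorem exists_singleton (hL : Reg L) (hne : L.Nonempty) : ∃ w ∈ L, Reg {w} := by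
  obtain ⟨Q, _, A, hA⟩ := hL
  obtain ⟨w, hw⟩ := hne
  obtain ⟨ρ, h1, h2, h3⟩ := (hA w).1 hw
  obtain ⟨q, hq, hq'⟩ : ∃ q ∈ A.accept, ∃ᶠ n in atTop, ρ n = q := by
    by_contra! hc
    obtain ⟨n, hn, hn'⟩ := (h3.and_eventually
      ((eventually_all_finite (Set.toFinite A.accept)).2 hc)).exists
    exact hn' _ hn rfl
  rw [frequently_atTop] at hq'
  obtain ⟨a, -, rfl⟩ := hq' 0
  obtain ⟨b, hab, hb⟩ := hq' (a + 1)
  -- The run has the same accepting state at `a < b`; `g` walks up to `b - 1` and then returns to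
  -- `a` forever, so the word is a lasso.
  let g : ℕ → ℕ := fun n => (fun i => if i + 1 = b then a else i + 1)^[n] 0
  have hg : ∀ n, g (n + 1) = if g n + 1 = b then a else g n + 1 := fun n =>
    Function.iterate_succ_apply' _ _ _
  have hgb : ∀ n, g n < b := fun n => by
    induction n with
    | zero => exact (Nat.zero_le _).trans_lt hab
    | succ n ih =>
      rw [hg]
      split_ifs <;> omega
  refine ⟨fun n => w (g n), (hA _).2 ⟨fun n => ρ (g n), h1, fun n => ?_, ?_⟩,
    singleton_lasso w rfl hgb hg⟩
  · have := h2 (g n)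
    simp only [hg]
    split_ifs with h
    · rwa [h, hb] at this
    · exact this
  · have hloop : ∀ n, ∃ m, n ≤ m ∧ g m = a := by
      intro n
      by_contra! hc
      have hinc : ∀ k, g (n + k) = g n + k := fun k => by
        induction k with
        | zero => rfl
        | succ k ih =>
          have h4 := hc (n + k + 1) (by omega)
          rw [hg] at h4
          rw [← add_assoc, hg, if_neg fun h => h4 (if_pos h), ih]
          omega
      have := hinc b
      have := hgb (n + b)
      omega
    rw [frequently_atTop]
    intro n
    obtain ⟨m, hm, hm'⟩ := hloop n
    exact ⟨m, hm, by simpa only [hm'] using hq⟩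

end Reg

/-! ### Unique representatives -/

theorem finite_setOf_eq_after {S : Type*} [Finite S] (w : ℕ → S) (N : ℕ) :
    {y : ℕ → S | ∀ n, N ≤ n → y n = w n}.Finite := by
  refine (Set.finite_range fun (g : Fin N → S) n => if h : n < N then g ⟨n, h⟩ else w n).subset ?_
  refine fun y hy => ⟨fun i => y i, funext fun n => ?_⟩
  by_cases h : n < N
  · simp [h]
  · simp [h, hy n (not_lt.1 h)]

theorem countable_of_metByEqualEndsClasses {S : Type*} [Finite S] {D : Set (ℕ → S)}
    {r : (ℕ → S) → (ℕ → S) → Prop} (hr : IsEquivalenceOn D r) {C : ℕ}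
    (h : MetByEqualEndsClasses D r C) : (classesOn D r).Countable := by
  obtain ⟨E, hE⟩ := h
  have hcount : ∀ w : ℕ → S, {y : ℕ → S | ∀ᶠ n in atTop, y n = w n}.Countable := fun w => by
    refine (Set.countable_iUnion fun N => (finite_setOf_eq_after w N).countable).mono ?_
    intro y hy
    obtain ⟨N, hN⟩ := eventually_atTop.1 hy
    exact Set.mem_iUnion.2 ⟨N, hN⟩
  refine (Set.countable_iUnion fun i => (hcount (E i).out).image fun y => {z | r y z}).mono ?_
  intro c hc
  obtain ⟨i, y, hy, hyi⟩ := hE c hc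
  obtain ⟨x, -, rfl⟩ := hc
  refine Set.mem_iUnion.2 ⟨i, y, ?_, ?_⟩
  · rw [← Quotient.out_eq (E i)] at hyi
    exact Quotient.exact hyi
  · ext z
    exact ⟨fun h => hr.trans hy h, fun h => hr.trans (hr.symm hy) h⟩

/-- `y` is less than `x` relative to `w`: at the last position where they differ, the letter of
`y` comes first in the enumeration `rk` of the letters that belongs to the letter of `w`. -/
def PrecedesAt {S : Type*} (rk : S → S → ℕ) (w y x : ℕ → S) : Prop :=
  ∃ n, rk (w n) (y n) < rk (w n) (x n) ∧ ∀ m, n < m → y m = x m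

/-! ### Comparing words at their last difference -/

section PrecedesAt

variable {S : Type*} {rk : S → S → ℕ} {w : ℕ → S}

theorem PrecedesAt.trans {x y z : ℕ → S} (h : PrecedesAt rk w x y) (h' : PrecedesAt rk w y z) :
    PrecedesAt rk w x z := by
  obtain ⟨n, h1, h2⟩ := h
  obtain ⟨m, h3, h4⟩ := h'
  rcases lt_trichotomy n m with h | rfl | h
  · exact ⟨m, h2 m h ▸ h3, fun k hk => (h2 k (h.trans hk)).trans (h4 k hk)⟩
  · exact ⟨n, h1.trans h3, fun k hk => (h2 k hk).trans (h4 k hk)⟩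
  · exact ⟨n, h4 n h ▸ h1, fun k hk => (h2 k hk).trans (h4 k (h.trans hk))⟩

theorem precedesAt_or (hrk : ∀ a, Function.Injective (rk a)) {x y : ℕ → S} (hne : x ≠ y)
    (h : ∀ᶠ n in atTop, x n = y n) : PrecedesAt rk w x y ∨ PrecedesAt rk w y x := by
  obtain ⟨N, hN⟩ := eventually_atTop.1 h
  have hfin : {n | x n ≠ y n}.Finite := (Set.finite_lt_nat N).subset fun n hn => by
    by_contra hc
    exact hn (hN n (not_lt.1 hc))
  obtain ⟨n, hn, hmax⟩ := hfin.exists_maximal (Function.ne_iff.1 hne)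
  have hafter : ∀ m, n < m → x m = y m := fun m hm => by
    by_contra hc
    exact absurd (hmax hc hm.le) (not_le.2 hm)
  rcases lt_or_gt_of_ne fun h => hn (hrk (w n) h) with h | h
  exacts [Or.inl ⟨n, h, hafter⟩, Or.inr ⟨n, h, fun m hm => (hafter m hm).symm⟩]

/-- Since the letter of `w` has the least rank, a word preceding one that equals `w` from `N` on
equals `w` from `N` on as well. The search for a minimum thus stays in a finite set. -/
theorem exists_first [Finite S] (hrk : ∀ a, rk a a = 0) {Y : Set (ℕ → S)} (hne : Y.Nonempty)
    (hY : ∀ y ∈ Y, ∀ᶠ n in atTop, y n = w n) : ∃ x ∈ Y, ∀ y ∈ Y, ¬ PrecedesAt rk w y x := by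
  obtain ⟨x₀, hx₀⟩ := hne
  obtain ⟨N, hN⟩ := eventually_atTop.1 (hY x₀ hx₀)
  let F : Set (ℕ → S) := Y ∩ {y | ∀ n, N ≤ n → y n = w n}
  have hfin : F.Finite :=
    (finite_setOf_eq_after w N).subset Set.inter_subset_right
  have := hfin.to_subtype
  let lt : F → F → Prop := fun y x => PrecedesAt rk w y x
  have htrans : IsTrans F lt := ⟨fun _ _ _ h h' => PrecedesAt.trans h h'⟩
  have hirr : Std.Irrefl lt := ⟨fun _ h => lt_irrefl _ h.choose_spec.1⟩
  obtain ⟨⟨x, hx, hxN⟩, -, hmin⟩ := (Finite.wellFounded_of_trans_of_irrefl lt).has_min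
    Set.univ ⟨⟨x₀, hx₀, hN⟩, trivial⟩
  refine ⟨x, hx, fun y hy hyx => hmin ⟨y, hy, ?_⟩ trivial hyx⟩
  obtain ⟨n, h1, h2⟩ := hyx
  intro m hm
  have hn : n < N := by
    by_contra hc
    rw [hxN n (not_lt.1 hc), hrk] at h1
    exact absurd h1 (Nat.not_lt_zero _)
  rw [h2 m (hn.trans_le hm), hxN m hm]

end PrecedesAt

theorem IsOmegaRegularRel.reg {α : Type*} {r : (ℕ → α) → (ℕ → α) → Prop}
    (h : IsOmegaRegularRel r) : Reg {w : ℕ → α × α | r (fun n => (w n).1) fun n => (w n).2} := by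
  obtain ⟨A, hA⟩ := h
  have : {w : ℕ → α × α | r (fun n => (w n).1) fun n => (w n).2} = {w | A.Accepts w} :=
    Set.ext fun w => hA _ _
  rw [this]
  exact A.reg

section representatives

variable {S : Type*} {D : Set (ℕ → S)} {r : (ℕ → S) → (ℕ → S) → Prop} {C : ℕ}

/-- If the ends of finitely many words occur in all classes, then the ends of the tracks of some
word occur in all classes which is ω-regular as a singleton. -/
theorem exists_regular_meeting (hreg : Reg {w : ℕ → S × S | r (fun n => (w n).1) fun n => (w n).2})
    (W : ℕ → Fin C → S) (hW : ∀ x, r x x → ∃ y, r x y ∧ ∃ i, ∀ᶠ n in atTop, y n = W n i) :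
    ∃ W : ℕ → Fin C → S, Reg {W} ∧
      ∀ x, r x x → ∃ y, r x y ∧ ∃ i, ∀ᶠ n in atTop, y n = W n i := by
  have h1 : Reg {v : ℕ → ((Fin C → S) × S) × S |
      r (fun n => (v n).1.2) fun n => (v n).2} :=
    hreg.comap fun a : ((Fin C → S) × S) × S => (a.1.2, a.2)
  have h2 : Reg (⋃ i, {v : ℕ → ((Fin C → S) × S) × S |
      ∀ᶠ n in atTop, (v n).2 = (v n).1.1 i}) :=
    Reg.iUnion fun i => Reg.eventually {a : ((Fin C → S) × S) × S | a.2 = a.1.1 i}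
  have h3 : Reg {v : ℕ → (Fin C → S) × S | r (fun n => (v n).2) fun n => (v n).2} :=
    hreg.comap fun a : (Fin C → S) × S => (a.2, a.2)
  -- The universal and existential quantifiers of the condition on the tuple become projections and
  -- complements.
  have h4 := ((h3.inter (h1.inter h2).proj.compl).proj).compl
  obtain ⟨W', hW', hreg'⟩ := h4.exists_singleton ⟨W, by
    rintro ⟨x, hx, hx'⟩
    obtain ⟨y, hxy, i, hi⟩ := hW x hx
    exact hx' ⟨y, hxy, Set.mem_iUnion.2 ⟨i, hi⟩⟩⟩
  refine ⟨W', hreg', fun x hx => ?_⟩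
  by_contra hc
  refine hW' ⟨x, hx, ?_⟩
  rintro ⟨y, hxy, hy⟩
  obtain ⟨i, hi⟩ := Set.mem_iUnion.1 hy
  exact hc ⟨y, hxy, i, hi⟩

theorem exists_regular_representativeSet [Finite S] (hr : IsEquivalenceOn D r)
    (hreg : Reg {w : ℕ → S × S | r (fun n => (w n).1) fun n => (w n).2})
    {W : ℕ → Fin C → S} (hWreg : Reg {W})
    (hW : ∀ x, r x x → ∃ y, r x y ∧ ∃ i, ∀ᶠ n in atTop, y n = W n i) :
    ∃ R : Set (ℕ → S), Reg R ∧ IsRepresentativeSet D r R := by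
  classical
  obtain ⟨ι, hι⟩ := exists_injective_nat S
  let rk : S → S → ℕ := fun a b => if b = a then 0 else ι b + 1
  have rk_self : ∀ a, rk a a = 0 := fun a => if_pos rfl
  have rk_inj : ∀ a, Function.Injective (rk a) := fun a b c h => by
    simp only [rk] at h
    split_ifs at h with h1 h2 h2
    · exact h1.trans h2.symm
    · exact hι (by omega)
  -- Having the ends of an earlier track beats everything; the order at the last difference only
  -- compares words with the ends of the same track.
  let better : (Fin C) → (ℕ → Fin C → S) → (ℕ → S) → (ℕ → S) → Prop := fun i W x y =>
    (∃ j : {j // j < i}, ∀ᶠ n in atTop, y n = W n j) ∨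
      (∀ᶠ n in atTop, y n = W n i) ∧ PrecedesAt rk (fun n => W n i) y x
  let R : Set (ℕ → S) := {x | r x x ∧ ∃ i, (∀ᶠ n in atTop, x n = W n i) ∧
    ¬ ∃ y, r x y ∧ better i W x y}
  have hR : Reg R := by
    have h1 : Reg {v : ℕ → (S × (Fin C → S)) × S |
        r (fun n => (v n).1.1) fun n => (v n).2} :=
      hreg.comap fun a : (S × (Fin C → S)) × S => (a.1.1, a.2)
    have h2 : ∀ i, Reg {v : ℕ → (S × (Fin C → S)) × S |
        ∀ᶠ n in atTop, (v n).2 = (v n).1.2 i} := fun i =>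
      Reg.eventually {a : (S × (Fin C → S)) × S | a.2 = a.1.2 i}
    have h3 : ∀ i, Reg {v : ℕ → (S × (Fin C → S)) × S |
        PrecedesAt rk (fun n => (v n).1.2 i) (fun n => (v n).2) fun n => (v n).1.1} := fun i =>
      Reg.eventually_after {a : (S × (Fin C → S)) × S | rk (a.1.2 i) a.2 < rk (a.1.2 i) a.1.1}
        {a | a.2 = a.1.1}
    have h4 : ∀ i, Reg {v : ℕ → (S × (Fin C → S)) × S |
        better i (fun n => (v n).1.2) (fun n => (v n).1.1) fun n => (v n).2} := fun i => by
      convert (Reg.iUnion fun j : {j // j < i} => h2 j).union ((h2 i).inter (h3 i)) using 1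
      ext v
      rw [Set.mem_union, Set.mem_iUnion]
      rfl
    have h5 : ∀ i, Reg {v : ℕ → S × (Fin C → S) | ∀ᶠ n in atTop, (v n).1 = (v n).2 i} :=
      fun i => Reg.eventually {a : S × (Fin C → S) | a.1 = a.2 i}
    have h6 : Reg {v : ℕ → S × (Fin C → S) | (fun n => (v n).2) ∈ ({W} : Set _)} :=
      hWreg.comap Prod.snd
    -- The tuple is fixed by its ω-regular singleton and then projected away; this is why `W` has to
    -- be ω-regular.
    have h7 := (h6.inter (Reg.iUnion fun i => (h5 i).inter (h1.inter (h4 i)).proj.compl)).proj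
    have h8 : Reg {x : ℕ → S | r x x} := hreg.comap fun a => (a, a)
    convert h8.inter h7 using 1
    ext x
    constructor
    · rintro ⟨hx, i, hi, hi'⟩
      exact ⟨hx, W, rfl, Set.mem_iUnion.2 ⟨i, hi, hi'⟩⟩
    · rintro ⟨hx, W', hW', hx'⟩
      obtain rfl : W' = W := hW'
      obtain ⟨i, hi, hi'⟩ := Set.mem_iUnion.1 hx'
      exact ⟨hx, i, hi, hi'⟩
  refine ⟨R, hR, fun x hx => (hr.mem hx.1).1, ?_⟩
  rintro _ ⟨x, hx, rfl⟩
  obtain ⟨i, ⟨z, hxz, hzi⟩, hi⟩ := (wellFounded_lt (α := Fin C)).has_min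
    {i | ∃ y, r x y ∧ ∀ᶠ n in atTop, y n = W n i} (by
      obtain ⟨y, hxy, i, hi⟩ := hW x (hr.refl hx)
      exact ⟨i, y, hxy, hi⟩)
  obtain ⟨y, ⟨hxy, hyi⟩, hy⟩ := exists_first (w := fun n => W n i) rk_self
    (Y := {y | r x y ∧ ∀ᶠ n in atTop, y n = W n i}) ⟨z, hxz, hzi⟩ fun y hy => hy.2
  refine ⟨y, ⟨⟨hr.refl (hr.mem hxy).2, i, hyi, ?_⟩, hxy⟩, ?_⟩
  · rintro ⟨z, hyz, ⟨⟨j, hj⟩, hzj⟩ | ⟨hzi, hlt⟩⟩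
    · exact hi j ⟨z, hr.trans hxy hyz, hzj⟩ hj
    · exact hy z ⟨hr.trans hxy hyz, hzi⟩ hlt
  · rintro z ⟨⟨-, k, hzk, hz⟩, hxz⟩
    have hzy : r z y := hr.trans (hr.symm hxz) hxy
    obtain rfl : k = i := by
      rcases lt_trichotomy k i with h | h | h
      · exact (hi k ⟨z, hxz, hzk⟩ h).elim
      · exact h
      · exact (hz ⟨y, hzy, Or.inl ⟨⟨i, h⟩, hyi⟩⟩).elim
    by_contra hne
    have hends : ∀ᶠ n in atTop, z n = y n := by
      filter_upwards [hzk, hyi] with n h1 h2 using h1.trans h2.symm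
    rcases precedesAt_or (w := fun n => W n k) rk_inj hne hends with h | h
    · exact hy z ⟨hxz, hzk⟩ h
    · exact hz ⟨y, hzy, Or.inr ⟨hyi, h⟩⟩

end representatives

/-- An ω-regular equivalence relation with countably many classes: finitely many equal-ends classes
meet all of its classes, and it has an ω-regular set of unique representatives. -/
theorem met_and_exists_representatives {S : Type*} [Finite S] {D : Set (ℕ → S)}
    {r : (ℕ → S) → (ℕ → S) → Prop} (hr : IsEquivalenceOn D r)
    (hreg : Reg {w : ℕ → S × S | r (fun n => (w n).1) fun n => (w n).2})
    (hc : (classesOn D r).Countable) :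
    (∃ C, MetByEqualEndsClasses D r C) ∧ ∃ R : Set (ℕ → S), Reg R ∧ IsRepresentativeSet D r R := by
  obtain ⟨M, _, _, φ, hφ⟩ := hreg.exists_saturates
  obtain ⟨s, hs⟩ := exists_finite_meeting_of_countable hr hφ hc
  let W : Fin s.card → ℕ → S := fun i => s.equivFin.symm i
  have hW : ∀ x ∈ D, ∃ y, r x y ∧ ∃ i, ∀ᶠ n in atTop, y n = W i n := fun x hx => by
    obtain ⟨y, hxy, z, hz, hyz⟩ := hs x hx
    exact ⟨y, hxy, s.equivFin ⟨z, hz⟩, by simpa [W] using hyz⟩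
  refine ⟨⟨s.card, fun i => Quotient.mk _ (W i), ?_⟩, ?_⟩
  · rintro _ ⟨x, hx, rfl⟩
    obtain ⟨y, hxy, i, hi⟩ := hW x hx
    exact ⟨i, y, hxy, Quotient.sound hi⟩
  · obtain ⟨W', h1, h2⟩ := exists_regular_meeting hreg (fun n i => W i n)
      fun x hx => hW x (hr.mem hx).1
    exact exists_regular_representativeSet hr hreg h1 h2

/-! ### Certificates for properties of all words -/

theorem seg_eq_prod {α M : Type*} [Monoid M] (φ : α → M) (w : ℕ → α) (l : List α) (a : ℕ)
    (h : ∀ (i : ℕ) (hi : i < l.length), w (a + i) = l[i]) :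
    seg φ w a (a + l.length) = (l.map φ).prod := by
  unfold seg
  congr 1
  refine List.ext_getElem (by simp) fun i h1 h2 => ?_
  simp only [List.length_map] at h2
  simp [List.Ico, h i h2]

namespace NBA

variable {α Q : Type*}

/-- The same automaton with other initial states. -/
def withStart (V : NBA α Q) (I : Set Q) : NBA α Q := { V with start := I }

/-- The profiles `s` and `e` of a factorization describe a word accepted from `I`. -/
def LassoFrom (I : Set Q) (s e : Profile Q) : Prop :=
  ∃ i ∈ I, ∃ f r, (i, f, r) ∈ s.triples ∧ (r, true, r) ∈ e.triples

/-- A set of profiles which contains those of the letters in `Ls`, is closed under products, and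
whose linked pairs `(s, e)` all have the property `Φ`, a property of the sets of initial states
from which words with these profiles are accepted. -/
structure IsCertificate {ι : Type*} (V : NBA α Q) (Ls : Set α) (I : ι → Set Q)
    (Φ : (ι → Prop) → Prop) (G : Set (Profile Q)) : Prop where
  letter : ∀ a ∈ Ls, V.letter a ∈ G
  mul : ∀ g ∈ G, ∀ h ∈ G, g * h ∈ G
  linked : ∀ s ∈ G, ∀ e ∈ G, e * e = e → s * e = s → Φ fun j => LassoFrom (I j) s e

variable {ι : Type*} {V : NBA α Q} {Ls : Set α} {I : ι → Set Q} {Φ : (ι → Prop) → Prop}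
  {K : Set Q}

theorem accepts_withStart_iff (hK : K.Finite) (hV : V.StatesIn K) {w : ℕ → α} {h : ℕ → ℕ}
    {s e : Profile Q} (H : IsFactorization V.letter w h s e) (J : Set Q) :
    (V.withStart J).Accepts w ↔ LassoFrom J s e :=
  accepts_iff_of_isFactorization (A := V.withStart J) hK hV H

/-- All block values lie in the finite set `G`, so Ramsey yields a linked pair in `G` that decides
acceptance from all sets of initial states at once. -/
theorem IsCertificate.sound (hK : K.Finite) (hV : V.StatesIn K) {G : Set (Profile Q)}
    (hG : G.Finite) (h : IsCertificate V Ls I Φ G) {w : ℕ → α} (hw : ∀ n, w n ∈ Ls) :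
    Φ fun j => (V.withStart (I j)).Accepts w := by
  have hseg : ∀ a b, a < b → seg V.letter w a b ∈ G := fun a b hab => by
    induction b, hab using Nat.le_induction with
    | base => simpa using h.letter _ (hw a)
    | succ b hab ih =>
      rw [seg_succ (Nat.le_of_succ_le hab)]
      exact h.mul _ ih _ (h.letter _ (hw b))
  obtain ⟨c, s, e, H, hs, he⟩ := exists_isFactorization_of_finite_range V.letter w hG hseg
  have := h.linked s hs e he H.idem H.absorb
  convert this using 2 with j
  exact accepts_withStart_iff hK hV H _

theorem exists_word_of_lists {M : Type*} [Monoid M] (φ : α → M) {l₁ l₂ : List α} (h₁ : l₁ ≠ [])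
    (h₂ : l₂ ≠ []) {s e : M} (hs : (l₁.map φ).prod = s) (he : (l₂.map φ).prod = e)
    (hee : e * e = e) (hse : s * e = s) :
    ∃ w h, IsFactorization φ w h s e ∧ ∀ n, w n ∈ l₁ ∨ w n ∈ l₂ := by
  have p₁ : 0 < l₁.length := List.length_pos_iff.2 h₁
  have p₂ : 0 < l₂.length := List.length_pos_iff.2 h₂
  let w : ℕ → α := fun i => if h : i < l₁.length then l₁[i] else
    l₂[(i - l₁.length) % l₂.length]'(Nat.mod_lt _ p₂)
  let h : ℕ → ℕ := fun n => n.casesOn 0 fun m => l₁.length + m * l₂.length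
  refine ⟨w, h, ⟨strictMono_nat_of_lt_succ fun n => ?_, rfl, ?_, fun n hn => ?_, hee, hse⟩,
    fun n => ?_⟩
  · rcases n with _ | n
    · change 0 < l₁.length + 0 * l₂.length
      omega
    · change l₁.length + n * l₂.length < l₁.length + (n + 1) * l₂.length
      rw [add_one_mul]
      omega
  · rw [← hs]
    have := seg_eq_prod φ w l₁ 0 fun i hi => by simp [w, hi]
    simpa [h] using this
  · obtain ⟨m, rfl⟩ := Nat.exists_eq_add_of_le' hn
    rw [← he]
    have := seg_eq_prod φ w l₂ (l₁.length + m * l₂.length) fun i hi => by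
      have h1 : ¬ l₁.length + m * l₂.length + i < l₁.length := by omega
      have h2 : (l₁.length + m * l₂.length + i - l₁.length) % l₂.length = i := by
        rw [show l₁.length + m * l₂.length + i - l₁.length = i + m * l₂.length by omega,
          Nat.add_mul_mod_self_right, Nat.mod_eq_of_lt hi]
      simp only [w, dif_neg h1, h2]
    rw [← this]
    change seg φ w (l₁.length + m * l₂.length) (l₁.length + (m + 1) * l₂.length) = _
    rw [add_one_mul, add_assoc]
  · simp only [w]
    split_ifs
    · exact Or.inl (List.getElem_mem _)
    · exact Or.inr (List.getElem_mem _)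

/-- Take the profiles of all nonempty finite words over `Ls`; each linked pair is realized by an
ultimately periodic word. The empty word is left out because the unit has triples at states outside
`K`. -/
theorem exists_isCertificate (hK : K.Finite) (hV : V.StatesIn K)
    (h : ∀ w : ℕ → α, (∀ n, w n ∈ Ls) → Φ fun j => (V.withStart (I j)).Accepts w) :
    ∃ G : Set (Profile Q), G.Finite ∧ (∀ g ∈ G, g.triples.Finite) ∧ IsCertificate V Ls I Φ G := by
  let B : Set (Q × Bool × Q) := K ×ˢ Set.univ ×ˢ K
  have hB : B.Finite := hK.prod (Set.finite_univ.prod hK)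
  let G : Set (Profile Q) := {g | ∃ l : List α, l ≠ [] ∧ (∀ a ∈ l, a ∈ Ls) ∧
    (l.map V.letter).prod = g}
  have hsub : ∀ g ∈ G, g.triples ⊆ B := by
    rintro _ ⟨l, hl, -, rfl⟩
    induction l with
    | nil => exact (hl rfl).elim
    | cons a l ih =>
      have ha : (V.letter a).triples ⊆ B := fun t ht => ⟨(hV ht.1).1, trivial, (hV ht.1).2⟩
      rcases eq_or_ne l [] with rfl | hl'
      · simpa using ha
      · rw [List.map_cons, List.prod_cons]
        rintro ⟨p, f, q⟩ ⟨r, f₁, f₂, h1, h2, -⟩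
        exact ⟨(ha h1).1, trivial, (ih hl' h2).2.2⟩
  refine ⟨G, ?_, fun g hg => hB.subset (hsub g hg), fun a ha => ⟨[a], by simp, by simpa, by simp⟩,
    ?_, ?_⟩
  · refine Set.Finite.of_finite_image (f := Profile.triples)
      (hB.finite_subsets.subset ?_) fun g _ g' _ hgg => Profile.ext hgg
    rintro _ ⟨g, hg, rfl⟩
    exact hsub g hg
  · rintro _ ⟨l, h1, h2, rfl⟩ _ ⟨l', h3, h4, rfl⟩
    refine ⟨l ++ l', by simp [h1], fun a ha => ?_, by simp⟩
    exact (List.mem_append.1 ha).elim (h2 a) (h4 a)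
  · rintro s ⟨l₁, h1, h1', hs⟩ e ⟨l₂, h2, h2', he⟩ hee hse
    obtain ⟨w, c, H, hw⟩ := exists_word_of_lists V.letter h1 h2 hs he hee hse
    have := h w fun n => (hw n).elim (h1' _) (h2' _)
    convert this using 2 with j
    exact (accepts_withStart_iff hK hV H _).symm

end NBA

/-! ### The automaton that reads a pair of words in several ways at once -/

namespace BuchiAutomaton

/-- How component `j` reads the pair of letters `a`: as the pair of letters `l`. -/
def Reads (k j : ℕ) (a l : ℕ × ℕ) : Prop :=
  (j = 0 ∨ j = 2) ∧ l = a ∨ (j = 1 ∨ j = 3) ∧ l = (a.1, a.1) ∨ j = 4 ∧ l = (a.2, a.2) ∨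
    j = 5 ∧ l.1 = a.1 ∧ l.2 < k ∨ j = 6 ∧ a.1 = a.2

/-- An automaton with a single state, whose only transition is a loop. -/
def loop : BuchiAutomaton (ℕ × ℕ) := ⟨[0], [(0, (0, 0), 0)], [0]⟩

/-- The automaton that component `j` runs. -/
def component (A P : BuchiAutomaton (ℕ × ℕ)) (j : ℕ) : BuchiAutomaton (ℕ × ℕ) :=
  if j < 2 then A else if j < 6 then P else loop

/-- All components together, without initial states. -/
def joint (k : ℕ) (A P : BuchiAutomaton (ℕ × ℕ)) : NBA (ℕ × ℕ) (ℕ × ℕ) where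
  start := ∅
  step p a q := p.1 < 7 ∧ q.1 = p.1 ∧
    ∃ l, Reads k p.1 a l ∧ (p.2, l, q.2) ∈ (component A P p.1).transitions
  accept := {p | p.2 ∈ (component A P p.1).accepting}

/-- The initial states of component `j`. -/
def jointStart (A P : BuchiAutomaton (ℕ × ℕ)) (j : ℕ) : Set (ℕ × ℕ) :=
  {p | p.1 = j ∧ p.2 ∈ (component A P j).initial}

variable {k : ℕ} {A P : BuchiAutomaton (ℕ × ℕ)}

theorem joint_accepts {j : ℕ} (hj : j < 7) {z : ℕ → ℕ × ℕ} :
    ((joint k A P).withStart (jointStart A P j)).Accepts z ↔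
      ∃ z', (∀ n, Reads k j (z n) (z' n)) ∧ (component A P j).Accepts z' := by
  constructor
  · rintro ⟨ρ, ⟨h1, h1'⟩, h2, h3⟩
    have hfst : ∀ n, (ρ n).1 = j := fun n => by
      induction n with
      | zero => exact h1
      | succ n ih => rw [(h2 n).2.1, ih]
    choose z' hz hz' using fun n => (h2 n).2.2
    refine ⟨z', fun n => hfst n ▸ hz n, fun n => (ρ n).2, ⟨h1', fun n => hfst n ▸ hz' n⟩,
      h3.mono fun n hn => ?_⟩
    have hn : (ρ n).2 ∈ (component A P (ρ n).1).accepting := hn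
    rwa [hfst n] at hn
  · rintro ⟨z', hz, ρ, ⟨h1, h2⟩, h3⟩
    exact ⟨fun n => (j, ρ n), ⟨rfl, h1⟩, fun n => ⟨hj, rfl, z' n, hz n, h2 n⟩, h3⟩

theorem exists_joint_statesIn (k : ℕ) (A P : BuchiAutomaton (ℕ × ℕ)) :
    ∃ K : Set (ℕ × ℕ), K.Finite ∧ (joint k A P).StatesIn K := by
  refine ⟨⋃ j ∈ Set.Iio 7, (fun p => (j, p)) ''
    {p | p ∈ (component A P j).transitions.map (fun t => t.1) ++
      (component A P j).transitions.map (fun t => t.2.2)}, ?_, ?_⟩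
  · exact (Set.finite_Iio 7).biUnion fun j _ => (List.finite_toSet _).image _
  · rintro ⟨j, p⟩ a ⟨j', q⟩ ⟨h1, h2, l, -, h3⟩
    obtain rfl : j' = j := h2
    refine ⟨Set.mem_biUnion h1 ⟨p, List.mem_append_left _ ?_, rfl⟩,
      Set.mem_biUnion h1 ⟨q, List.mem_append_right _ ?_, rfl⟩⟩
    · exact List.mem_map.2 ⟨_, h3, rfl⟩
    · exact List.mem_map.2 ⟨_, h3, rfl⟩

/-- The pairs of words related by `A`. -/
def Rel (A : BuchiAutomaton (ℕ × ℕ)) {k : ℕ} (x y : ℕ → Fin k) : Prop :=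
  A.Accepts (convolution (natWord x) (natWord y))

/-- The automaton `P` relates every word that `A` relates to itself to words in a set of unique
representatives, expressed through the components of the joint automaton. -/
def SelectsComponents (v : ℕ → Prop) : Prop :=
  (v 2 → v 0) ∧ (v 1 → v 5) ∧ (v 2 → v 4) ∧ (v 3 ∧ v 4 ∧ v 0 → v 6)

/-- The one existential claim is absorbed by component `5`, which guesses the second track, with
letters below `k` so that the guess is a word over the alphabet. What remains is a Boolean condition
on the pair `x, y`. -/
theorem selectsComponents_joint_iff {x y : ℕ → Fin k} :
    (SelectsComponents fun j => ((joint k A P).withStart (jointStart A P j)).Accepts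
      (convolution (natWord x) (natWord y))) ↔
    (P.Rel x y → A.Rel x y) ∧ (A.Rel x x → ∃ y' : ℕ → Fin k, P.Rel x y') ∧
      (P.Rel x y → P.Rel y y) ∧ (P.Rel x x ∧ P.Rel y y ∧ A.Rel x y → x = y) := by
  have fixed : ∀ {B : BuchiAutomaton (ℕ × ℕ)} {g : ℕ → ℕ × ℕ},
      (∃ z', (∀ n, z' n = g n) ∧ B.Accepts z') ↔ B.Accepts g := fun {B g} =>
    ⟨fun ⟨z', h, h'⟩ => (funext h : z' = g) ▸ h', fun h => ⟨g, fun _ => rfl, h⟩⟩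
  have h5 : (∃ z', (∀ n, (z' n).1 = (x n : ℕ) ∧ (z' n).2 < k) ∧ P.Accepts z') ↔
      ∃ y' : ℕ → Fin k, P.Rel x y' := by
    constructor
    · rintro ⟨z', h, h'⟩
      refine ⟨fun n => ⟨(z' n).2, (h n).2⟩, ?_⟩
      have : z' = convolution (natWord x) fun n => (z' n).2 :=
        funext fun n => Prod.ext (h n).1 rfl
      rwa [this] at h'
    · rintro ⟨y', h⟩
      exact ⟨_, fun n => ⟨rfl, (y' n).2⟩, h⟩
  have h6 : (∃ z' : ℕ → ℕ × ℕ, (∀ n, (x n : ℕ) = (y n : ℕ)) ∧ loop.Accepts z') ↔ x = y := by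
    constructor
    · rintro ⟨_, h, -⟩
      exact funext fun n => Fin.ext (h n)
    · rintro rfl
      exact ⟨fun _ => (0, 0), fun _ => rfl, fun _ => 0, ⟨by simp [loop], fun _ => by simp [loop]⟩,
        (Eventually.of_forall fun _ => by simp [loop]).frequently⟩
  have e {j : ℕ} (hj : j < 7) := joint_accepts (k := k) (A := A) (P := P) hj
    (z := convolution (natWord x) (natWord y))
  have c0 := (e (j := 0) (by norm_num)).trans (show _ ↔ A.Rel x y by
    simpa [Reads, component, Rel] using fixed (B := A))
  have c1 := (e (j := 1) (by norm_num)).trans (show _ ↔ A.Rel x x by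
    simp [Reads, component]
    exact fixed (B := A) (g := convolution (natWord x) (natWord x)))
  have c2 := (e (j := 2) (by norm_num)).trans (show _ ↔ P.Rel x y by
    simpa [Reads, component, Rel] using fixed (B := P))
  have c3 := (e (j := 3) (by norm_num)).trans (show _ ↔ P.Rel x x by
    simp [Reads, component]
    exact fixed (B := P) (g := convolution (natWord x) (natWord x)))
  have c4 := (e (j := 4) (by norm_num)).trans (show _ ↔ P.Rel y y by
    simp [Reads, component]
    exact fixed (B := P) (g := convolution (natWord y) (natWord y)))
  have c5 := (e (j := 5) (by norm_num)).trans (Iff.trans (by simp [Reads]; rfl) h5)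
  have c6 := (e (j := 6) (by norm_num)).trans (Iff.trans (by simp [Reads]; rfl) h6)
  exact and_congr (imp_congr c2 c0) (and_congr (imp_congr c1 c5)
    (and_congr (imp_congr c2 c4) (imp_congr (and_congr c3 (and_congr c4 c0)) c6)))

end BuchiAutomaton

/-! ### Certificates as lists -/

namespace BuchiAutomaton

/-- An element of a profile of the joint automaton. -/
abbrev Triple := (ℕ × ℕ) × Bool × (ℕ × ℕ)

/-- A profile of the joint automaton, as a list. -/
abbrev ProfileList := List Triple

/-- The profile that a list represents. -/
def ProfileList.toProfile (g : ProfileList) : Profile (ℕ × ℕ) := ⟨{t | t ∈ g}⟩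

/-- The triple `t` describes the transition `τ` of component `j`. -/
def Describes (A P : BuchiAutomaton (ℕ × ℕ)) (j : ℕ) (τ : ℕ × (ℕ × ℕ) × ℕ)
    (t : Triple) : Prop :=
  t.1 = (j, τ.1) ∧ t.2.2 = (j, τ.2.2) ∧
    (t.2.1 = true ∧ τ.1 ∈ (component A P j).accepting ∨
      t.2.1 = false ∧ ¬ τ.1 ∈ (component A P j).accepting)

/-- The list `g` represents the profile of the letter `a`. -/
def IsLetterList (k : ℕ) (A P : BuchiAutomaton (ℕ × ℕ)) (a : ℕ × ℕ) (g : ProfileList) : Prop :=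
  (∀ t ∈ g, ∃ j ∈ List.range 7, ∃ τ ∈ (component A P j).transitions,
    Reads k j a τ.2.1 ∧ Describes A P j τ t) ∧
  ∀ j ∈ List.range 7, ∀ τ ∈ (component A P j).transitions, ¬ Reads k j a τ.2.1 ∨
    ∃ t ∈ g, Describes A P j τ t

/-- The list `l` represents the product of the profiles represented by `g` and `h`. -/
def IsProductList (g h l : ProfileList) : Prop :=
  (∀ t ∈ l, ∃ u ∈ g, ∃ v ∈ h, u.2.2 = v.1 ∧ t = (u.1, (u.2.1 || v.2.1), v.2.2)) ∧
  ∀ u ∈ g, ∀ v ∈ h, ¬ u.2.2 = v.1 ∨ ∃ t ∈ l, t = (u.1, (u.2.1 || v.2.1), v.2.2)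

/-- Component `j` accepts the words with the profiles represented by `s` and `e`. -/
def AcceptsLists (A P : BuchiAutomaton (ℕ × ℕ)) (j : ℕ) (s e : ProfileList) : Prop :=
  ∃ i ∈ (component A P j).initial, ∃ t ∈ s, ∃ u ∈ e,
    t.1 = (j, i) ∧ t.2.2 = u.1 ∧ u.2.1 = true ∧ u.2.2 = u.1

/-- The condition that the algorithm checks. -/
def IsListCertificate (k : ℕ) (A P : BuchiAutomaton (ℕ × ℕ)) (G : List ProfileList) : Prop :=
  (∀ c ∈ List.range k, ∀ d ∈ List.range k, ∃ g ∈ G, IsLetterList k A P (c, d) g) ∧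
  (∀ g ∈ G, ∀ h ∈ G, ∃ l ∈ G, IsProductList g h l) ∧
  ∀ s ∈ G, ∀ e ∈ G, ¬ IsProductList e e e ∨ ¬ IsProductList s e s ∨
    (¬ AcceptsLists A P 2 s e ∨ AcceptsLists A P 0 s e) ∧
    (¬ AcceptsLists A P 1 s e ∨ AcceptsLists A P 5 s e) ∧
    (¬ AcceptsLists A P 2 s e ∨ AcceptsLists A P 4 s e) ∧
    (¬ (AcceptsLists A P 3 s e ∧ AcceptsLists A P 4 s e ∧ AcceptsLists A P 0 s e) ∨
      AcceptsLists A P 6 s e)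

variable {k : ℕ} {A P : BuchiAutomaton (ℕ × ℕ)}

theorem isLetterList_iff {a : ℕ × ℕ} {g : ProfileList} :
    IsLetterList k A P a g ↔ (joint k A P).letter a = g.toProfile := by
  have hdes : ∀ {j : ℕ} {τ : ℕ × (ℕ × ℕ) × ℕ} {t : Triple},
      Describes A P j τ t ↔ t.1 = (j, τ.1) ∧ t.2.2 = (j, τ.2.2) ∧
        (t.2.1 = true ↔ τ.1 ∈ (component A P j).accepting) := fun {j τ t} => by
    unfold Describes
    cases t.2.1 <;> simp
  have hmem : ∀ t, t ∈ ((joint k A P).letter a).triples ↔ ∃ j ∈ List.range 7,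
      ∃ τ ∈ (component A P j).transitions, Reads k j a τ.2.1 ∧ Describes A P j τ t := by
    rintro ⟨⟨j, p⟩, f, ⟨j', q⟩⟩
    constructor
    · rintro ⟨⟨h1, h2, l, h3, h4⟩, h5⟩
      obtain rfl : j' = j := h2
      exact ⟨j', List.mem_range.2 h1, _, h4, h3, hdes.2 ⟨rfl, rfl, h5⟩⟩
    · rintro ⟨i, hi, ⟨p', l, q'⟩, h1, h2, h3⟩
      obtain ⟨h3, h4, h5⟩ := hdes.1 h3
      simp only [Prod.mk.injEq] at h3 h4
      obtain ⟨rfl, rfl⟩ := h3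
      obtain ⟨rfl, rfl⟩ := h4
      exact ⟨⟨List.mem_range.1 hi, rfl, l, h2, h1⟩, h5⟩
  constructor
  · rintro ⟨h1, h2⟩
    refine Profile.ext (Set.ext fun t => (hmem t).trans ⟨?_, h1 t⟩)
    rintro ⟨j, hj, τ, h3, h4, h5⟩
    obtain ⟨t', h6, h7⟩ := (h2 j hj τ h3).resolve_left (not_not.2 h4)
    rw [hdes] at h5 h7
    obtain rfl : t = t' := Prod.ext (h5.1.trans h7.1.symm) (Prod.ext
      (Bool.eq_iff_iff.2 (h5.2.2.trans h7.2.2.symm)) (h5.2.1.trans h7.2.1.symm))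
    exact h6
  · intro h
    have hmem' : ∀ t, t ∈ g ↔ _ := fun t => Iff.trans
      (show t ∈ g ↔ t ∈ ((joint k A P).letter a).triples by rw [h]; rfl) (hmem t)
    refine ⟨fun t => (hmem' t).1, fun j hj τ hτ => ?_⟩
    classical
    rw [← imp_iff_not_or]
    intro hR
    have hd : Describes A P j τ
        ((j, τ.1), decide (τ.1 ∈ (component A P j).accepting), (j, τ.2.2)) :=
      hdes.2 ⟨rfl, rfl, by simp⟩
    exact ⟨_, (hmem' _).2 ⟨j, hj, τ, hτ, hR, hd⟩, hd⟩

theorem isProductList_iff {g h l : ProfileList} :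
    IsProductList g h l ↔ g.toProfile * h.toProfile = l.toProfile := by
  have hmem : ∀ t, t ∈ (g.toProfile * h.toProfile).triples ↔
      ∃ u ∈ g, ∃ v ∈ h, u.2.2 = v.1 ∧ t = (u.1, (u.2.1 || v.2.1), v.2.2) := by
    rintro ⟨p, f, q⟩
    constructor
    · rintro ⟨r, f₁, f₂, h1, h2, h3⟩
      exact ⟨_, h1, _, h2, rfl, by rw [← h3]⟩
    · rintro ⟨⟨p', f₁, r⟩, h1, ⟨r', f₂, q'⟩, h2, h3, h4⟩
      simp only [Prod.mk.injEq] at h3 h4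
      obtain ⟨rfl, rfl, rfl⟩ := h4
      subst h3
      exact ⟨_, _, _, h1, h2, rfl⟩
  constructor
  · rintro ⟨h1, h2⟩
    refine Profile.ext (Set.ext fun t => (hmem t).trans ⟨?_, h1 t⟩)
    rintro ⟨u, hu, v, hv, huv, rfl⟩
    obtain ⟨t, ht, rfl⟩ := (h2 u hu v hv).resolve_left (not_not.2 huv)
    exact ht
  · intro H
    have hmem' : ∀ t, t ∈ l ↔ _ := fun t => Iff.trans
      (show t ∈ l ↔ t ∈ (g.toProfile * h.toProfile).triples by rw [H]; rfl) (hmem t)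
    refine ⟨fun t => (hmem' t).1, fun u hu v hv => ?_⟩
    rw [← imp_iff_not_or]
    exact fun huv => ⟨_, (hmem' _).2 ⟨u, hu, v, hv, huv, rfl⟩, rfl⟩

theorem acceptsLists_iff {j : ℕ} {s e : ProfileList} :
    AcceptsLists A P j s e ↔ NBA.LassoFrom (jointStart A P j) s.toProfile e.toProfile := by
  constructor
  · rintro ⟨i, hi, ⟨p, f, q⟩, ht, ⟨r, g, q'⟩, hu, h1, h2, h3, h4⟩
    simp only at h1 h2 h3 h4
    subst h1 h2 h3 h4
    exact ⟨(j, i), ⟨rfl, hi⟩, f, _, ht, hu⟩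
  · rintro ⟨⟨_, i⟩, ⟨rfl, hi⟩, f, r, ht, hu⟩
    exact ⟨i, hi, _, ht, _, hu, rfl, rfl, rfl, rfl⟩

/-- The list version uses only quantifiers bounded by lists, negations, conjunctions and
disjunctions, the shapes under which primitive recursive predicates are closed. -/
theorem isListCertificate_iff {G : List ProfileList} :
    IsListCertificate k A P G ↔ (joint k A P).IsCertificate {a | a.1 < k ∧ a.2 < k}
      (jointStart A P) SelectsComponents {g | ∃ l ∈ G, l.toProfile = g} := by
  unfold IsListCertificate
  simp only [isLetterList_iff, isProductList_iff, acceptsLists_iff, ← imp_iff_not_or,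
    List.mem_range]
  constructor
  · rintro ⟨h1, h2, h3⟩
    refine ⟨fun a ha => ?_, ?_, ?_⟩
    · obtain ⟨g, hg, h⟩ := h1 a.1 ha.1 a.2 ha.2
      exact ⟨g, hg, h.symm⟩
    · rintro _ ⟨g, hg, rfl⟩ _ ⟨h, hh, rfl⟩
      obtain ⟨l, hl, H⟩ := h2 g hg h hh
      exact ⟨l, hl, H.symm⟩
    · rintro _ ⟨s, hs, rfl⟩ _ ⟨e, he, rfl⟩ hee hse
      exact h3 s hs e he hee hse
  · rintro ⟨h1, h2, h3⟩
    refine ⟨fun c hc d hd => ?_, fun g hg h hh => ?_, fun s hs e he hee hse =>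
      h3 _ ⟨s, hs, rfl⟩ _ ⟨e, he, rfl⟩ hee hse⟩
    · obtain ⟨g, hg, h⟩ := h1 (c, d) ⟨hc, hd⟩
      exact ⟨g, hg, h.symm⟩
    · obtain ⟨l, hl, H⟩ := h2 _ ⟨g, hg, rfl⟩ _ ⟨h, hh, rfl⟩
      exact ⟨l, hl, H.symm⟩

/-- The relation of `P` selects, for each word that `A` relates to itself, one of the words which
`A` relates to it. -/
def Selects (k : ℕ) (A P : BuchiAutomaton (ℕ × ℕ)) : Prop :=
  ∀ x y : ℕ → Fin k, (P.Rel x y → A.Rel x y) ∧ (A.Rel x x → ∃ y' : ℕ → Fin k, P.Rel x y') ∧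
      (P.Rel x y → P.Rel y y) ∧ (P.Rel x x ∧ P.Rel y y ∧ A.Rel x y → x = y)

theorem selects_iff : Selects k A P ↔
    ∀ z : ℕ → ℕ × ℕ, (∀ n, z n ∈ {a : ℕ × ℕ | a.1 < k ∧ a.2 < k}) →
    SelectsComponents fun j => ((joint k A P).withStart (jointStart A P j)).Accepts z := by
  constructor
  · intro h z hz
    exact selectsComponents_joint_iff.2
      (h (fun n => ⟨(z n).1, (hz n).1⟩) fun n => ⟨(z n).2, (hz n).2⟩)
  · exact fun h x y => selectsComponents_joint_iff.1 (h _ fun n => ⟨(x n).2, (y n).2⟩)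

theorem exists_isListCertificate_iff : (∃ G, IsListCertificate k A P G) ↔ Selects k A P := by
  obtain ⟨K, hK, hV⟩ := exists_joint_statesIn k A P
  simp only [isListCertificate_iff, selects_iff]
  constructor
  · rintro ⟨G, hG⟩ z hz
    exact hG.sound hK hV ((List.finite_toSet G).image ProfileList.toProfile) hz
  · intro h
    obtain ⟨G, hG, hfin, H⟩ := NBA.exists_isCertificate hK hV h
    have hlist : ∀ g ∈ G, ∃ l : ProfileList, l.toProfile = g := fun g hg =>
      ⟨(hfin g hg).toFinset.toList, Profile.ext (Set.ext fun t => by simp [ProfileList.toProfile])⟩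
    choose! c hc using hlist
    refine ⟨hG.toFinset.toList.map c, ?_⟩
    convert H using 1
    ext g
    constructor
    · rintro ⟨l, hl, rfl⟩
      obtain ⟨g, hg, rfl⟩ := List.mem_map.1 hl
      have hg : g ∈ G := by simpa using hg
      rwa [hc g hg]
    · exact fun hg => ⟨c g, List.mem_map_of_mem (by simpa using hg), hc g hg⟩

/-- The automaton for the set of words that `P` relates to themselves. -/
def diagonal (P : BuchiAutomaton (ℕ × ℕ)) : BuchiAutomaton ℕ :=
  ⟨P.initial, P.transitions.filterMap fun t =>
    if t.2.1.1 = t.2.1.2 then some (t.1, t.2.1.1, t.2.2) else none, P.accepting⟩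

theorem diagonal_accepts {w : ℕ → ℕ} : P.diagonal.Accepts w ↔ P.Accepts (convolution w w) := by
  have : ∀ {p a q}, (p, a, q) ∈ P.diagonal.transitions ↔ (p, (a, a), q) ∈ P.transitions := by
    intro p a q
    simp only [diagonal, List.mem_filterMap]
    constructor
    · rintro ⟨⟨p', ⟨b, c⟩, q'⟩, h1, h2⟩
      split_ifs at h2 with h3
      simp only [Option.some_inj, Prod.mk.injEq] at h2 h3
      obtain ⟨rfl, rfl, rfl⟩ := h2
      rwa [h3] at h1 ⊢
    · exact fun h => ⟨_, h, by simp⟩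
  constructor
  · rintro ⟨ρ, ⟨h1, h2⟩, h3⟩
    exact ⟨ρ, ⟨h1, fun i => this.1 (h2 i)⟩, h3⟩
  · rintro ⟨ρ, ⟨h1, h2⟩, h3⟩
    exact ⟨ρ, ⟨h1, fun i => this.2 (h2 i)⟩, h3⟩

end BuchiAutomaton

/-! ### The algorithm -/

namespace PrimrecPred

variable {σ α : Type*} [Primcodable σ] [Primcodable α] {l : σ → List α} {p : σ × α → Prop}

/-- The parameter `s` is carried along in a pair, so that nested bounded quantifiers can be peeled
off one by one. -/
theorem ball (hl : Primrec l) (hp : PrimrecPred p) :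
    PrimrecPred fun s => ∀ a ∈ l s, p (s, a) :=
  (PrimrecRel.forall_mem_list (R := fun a s => p (s, a))
    (hp.comp (Primrec.snd.pair Primrec.fst))).comp hl Primrec.id

theorem bex (hl : Primrec l) (hp : PrimrecPred p) :
    PrimrecPred fun s => ∃ a ∈ l s, p (s, a) :=
  (PrimrecRel.exists_mem_list (R := fun a s => p (s, a))
    (hp.comp (Primrec.snd.pair Primrec.fst))).comp hl Primrec.id

end PrimrecPred

namespace BuchiAutomaton

open Primrec

theorem primrec_equivProd {α : Type*} [Primcodable α] : Primrec (equivProd α) :=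
  Primrec.of_equiv

theorem primrec_equivProd_symm {α : Type*} [Primcodable α] : Primrec (equivProd α).symm :=
  Primrec.of_equiv_symm

/-! ### Primitive recursiveness of the certificate check -/

section

variable {σ : Type} [Primcodable σ] {A P : σ → BuchiAutomaton (ℕ × ℕ)} {k j : σ → ℕ}
  {a l : σ → ℕ × ℕ} {g h m : σ → ProfileList} {τ : σ → ℕ × (ℕ × ℕ) × ℕ}
  {t : σ → Triple}

theorem primrec_initial (hA : Primrec A) : Primrec fun s => (A s).initial :=
  fst.comp (primrec_equivProd.comp hA)

theorem primrec_transitions (hA : Primrec A) : Primrec fun s => (A s).transitions :=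
  fst.comp (snd.comp (primrec_equivProd.comp hA))

theorem primrec_accepting (hA : Primrec A) : Primrec fun s => (A s).accepting :=
  snd.comp (snd.comp (primrec_equivProd.comp hA))

theorem primrec_component (hA : Primrec A) (hP : Primrec P) (hj : Primrec j) :
    Primrec fun s => component (A s) (P s) (j s) :=
  ite (nat_lt.comp hj (const 2)) hA (ite (nat_lt.comp hj (const 6)) hP (const loop))

theorem primrecPred_reads (hk : Primrec k) (hj : Primrec j) (ha : Primrec a) (hl : Primrec l) :
    PrimrecPred fun s => Reads (k s) (j s) (a s) (l s) := by
  have e {n : ℕ} : PrimrecPred fun s => j s = n := Primrec.eq.comp hj (const n)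
  have a1 := fst.comp ha
  have a2 := snd.comp ha
  exact ((e.or e).and (Primrec.eq.comp hl ha)).or <|
    ((e.or e).and (Primrec.eq.comp hl (a1.pair a1))).or <|
    (e.and (Primrec.eq.comp hl (a2.pair a2))).or <|
    (e.and ((Primrec.eq.comp (fst.comp hl) a1).and (nat_lt.comp (snd.comp hl) hk))).or <|
    e.and (Primrec.eq.comp a1 a2)

theorem primrecPred_describes (hA : Primrec A) (hP : Primrec P) (hj : Primrec j)
    (hτ : Primrec τ) (ht : Primrec t) :
    PrimrecPred fun s => Describes (A s) (P s) (j s) (τ s) (t s) := by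
  have hacc : PrimrecPred fun s => (τ s).1 ∈ (component (A s) (P s) (j s)).accepting :=
    (PrimrecPred.bex (primrec_accepting (primrec_component hA hP hj))
      (p := fun q => q.2 = (τ q.1).1)
      (Primrec.eq.comp snd (fst.comp (hτ.comp fst)))).of_eq fun s => by simp
  have hb {b : Bool} : PrimrecPred fun s => (t s).2.1 = b :=
    Primrec.eq.comp (fst.comp (snd.comp ht)) (const b)
  exact (Primrec.eq.comp (fst.comp ht) (hj.pair (fst.comp hτ))).and <|
    (Primrec.eq.comp (snd.comp (snd.comp ht)) (hj.pair (snd.comp (snd.comp hτ)))).and <|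
    (hb.and hacc).or (hb.and hacc.not)

theorem primrecPred_isLetterList (hk : Primrec k) (hA : Primrec A) (hP : Primrec P)
    (ha : Primrec a) (hg : Primrec g) :
    PrimrecPred fun s => IsLetterList (k s) (A s) (P s) (a s) (g s) := by
  refine PrimrecPred.and ?_ ?_
  · refine PrimrecPred.ball hg (p := fun q => ∃ j ∈ List.range 7,
      ∃ τ ∈ (component (A q.1) (P q.1) j).transitions,
        Reads (k q.1) j (a q.1) τ.2.1 ∧ Describes (A q.1) (P q.1) j τ q.2) ?_
    refine PrimrecPred.bex (const _) (p := fun q : (σ × Triple) × ℕ =>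
      ∃ τ ∈ (component (A q.1.1) (P q.1.1) q.2).transitions,
        Reads (k q.1.1) q.2 (a q.1.1) τ.2.1 ∧ Describes (A q.1.1) (P q.1.1) q.2 τ q.1.2) ?_
    have c1 := fst.comp (fst (α := σ × Triple) (β := ℕ))
    refine PrimrecPred.bex (primrec_transitions (primrec_component (hA.comp c1) (hP.comp c1) snd))
      (p := fun q : ((σ × Triple) × ℕ) × (ℕ × (ℕ × ℕ) × ℕ) =>
        Reads (k q.1.1.1) q.1.2 (a q.1.1.1) q.2.2.1 ∧
        Describes (A q.1.1.1) (P q.1.1.1) q.1.2 q.2 q.1.1.2) ?_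
    have c2 := c1.comp (fst (β := ℕ × (ℕ × ℕ) × ℕ))
    exact (primrecPred_reads (hk.comp c2) (snd.comp fst) (ha.comp c2)
      (fst.comp (snd.comp snd))).and (primrecPred_describes (hA.comp c2) (hP.comp c2)
        (snd.comp fst) snd (snd.comp (fst.comp fst)))
  · refine PrimrecPred.ball (const _) (p := fun q =>
      ∀ τ ∈ (component (A q.1) (P q.1) q.2).transitions, ¬ Reads (k q.1) q.2 (a q.1) τ.2.1 ∨
        ∃ t ∈ g q.1, Describes (A q.1) (P q.1) q.2 τ t) ?_
    refine PrimrecPred.ball (primrec_transitions (primrec_component (hA.comp fst) (hP.comp fst)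
      snd)) (p := fun q : (σ × ℕ) × (ℕ × (ℕ × ℕ) × ℕ) =>
        ¬ Reads (k q.1.1) q.1.2 (a q.1.1) q.2.2.1 ∨
        ∃ t ∈ g q.1.1, Describes (A q.1.1) (P q.1.1) q.1.2 q.2 t) ?_
    have c2 := fst.comp (fst (α := σ × ℕ) (β := ℕ × (ℕ × ℕ) × ℕ))
    refine (primrecPred_reads (hk.comp c2) (snd.comp fst) (ha.comp c2)
      (fst.comp (snd.comp snd))).not.or ?_
    refine PrimrecPred.bex (hg.comp c2) (p := fun q =>
      Describes (A q.1.1.1) (P q.1.1.1) q.1.1.2 q.1.2 q.2) ?_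
    have c3 := c2.comp (fst (β := Triple))
    exact primrecPred_describes (hA.comp c3) (hP.comp c3) (snd.comp (fst.comp fst))
      (snd.comp fst) snd

theorem primrecPred_isProductList (hg : Primrec g) (hh : Primrec h) (hm : Primrec m) :
    PrimrecPred fun s => IsProductList (g s) (h s) (m s) := by
  have hprod {σ' : Type} [Primcodable σ'] {u v : σ' → Triple}
      (hu : Primrec u) (hv : Primrec v) :
      Primrec fun q => ((u q).1, ((u q).2.1 || (v q).2.1), (v q).2.2) :=
    (fst.comp hu).pair ((Primrec.or.comp (fst.comp (snd.comp hu)) (fst.comp (snd.comp hv))).pair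
      (snd.comp (snd.comp hv)))
  refine PrimrecPred.and ?_ ?_
  · refine PrimrecPred.ball hm (p := fun q => ∃ u ∈ g q.1, ∃ v ∈ h q.1,
      u.2.2 = v.1 ∧ q.2 = (u.1, (u.2.1 || v.2.1), v.2.2)) ?_
    refine PrimrecPred.bex (hg.comp fst) (p := fun q => ∃ v ∈ h q.1.1,
      q.2.2.2 = v.1 ∧ q.1.2 = (q.2.1, (q.2.2.1 || v.2.1), v.2.2)) ?_
    refine PrimrecPred.bex (hh.comp (fst.comp fst)) (p := fun q : ((σ × Triple) × Triple) × Triple =>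
      q.1.2.2.2 = q.2.1 ∧ q.1.1.2 = (q.1.2.1, (q.1.2.2.1 || q.2.2.1), q.2.2.2)) ?_
    exact (Primrec.eq.comp (snd.comp (snd.comp (snd.comp fst))) (fst.comp snd)).and
      (Primrec.eq.comp (snd.comp (fst.comp fst)) (hprod (snd.comp fst) snd))
  · refine PrimrecPred.ball hg (p := fun q => ∀ v ∈ h q.1, ¬ q.2.2.2 = v.1 ∨
      ∃ t ∈ m q.1, t = (q.2.1, (q.2.2.1 || v.2.1), v.2.2)) ?_
    refine PrimrecPred.ball (hh.comp fst) (p := fun q : (σ × Triple) × Triple => ¬ q.1.2.2.2 = q.2.1 ∨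
      ∃ t ∈ m q.1.1, t = (q.1.2.1, (q.1.2.2.1 || q.2.2.1), q.2.2.2)) ?_
    refine (Primrec.eq.comp (snd.comp (snd.comp (snd.comp fst))) (fst.comp snd)).not.or ?_
    refine PrimrecPred.bex (hm.comp (fst.comp fst)) (p := fun q : ((σ × Triple) × Triple) × Triple =>
      q.2 = (q.1.1.2.1, (q.1.1.2.2.1 || q.1.2.2.1), q.1.2.2.2)) ?_
    exact Primrec.eq.comp snd (hprod (snd.comp (fst.comp fst)) (snd.comp fst))

theorem primrecPred_acceptsLists (hA : Primrec A) (hP : Primrec P) (i : ℕ) (hg : Primrec g)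
    (hh : Primrec h) : PrimrecPred fun s => AcceptsLists (A s) (P s) i (g s) (h s) := by
  refine PrimrecPred.bex (primrec_initial (primrec_component hA hP (const i))) (p := fun q =>
    ∃ t ∈ g q.1, ∃ u ∈ h q.1, t.1 = (i, q.2) ∧ t.2.2 = u.1 ∧ u.2.1 = true ∧ u.2.2 = u.1) ?_
  refine PrimrecPred.bex (hg.comp fst) (p := fun q => ∃ u ∈ h q.1.1,
    q.2.1 = (i, q.1.2) ∧ q.2.2.2 = u.1 ∧ u.2.1 = true ∧ u.2.2 = u.1) ?_
  refine PrimrecPred.bex (hh.comp (fst.comp fst)) (p := fun q : ((σ × ℕ) × Triple) × Triple =>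
    q.1.2.1 = (i, q.1.1.2) ∧ q.1.2.2.2 = q.2.1 ∧ q.2.2.1 = true ∧ q.2.2.2 = q.2.1) ?_
  exact (Primrec.eq.comp (fst.comp (snd.comp fst)) ((const i).pair (snd.comp (fst.comp fst)))).and
    <| (Primrec.eq.comp (snd.comp (snd.comp (snd.comp fst))) (fst.comp snd)).and <|
    (Primrec.eq.comp (fst.comp (snd.comp snd)) (const true)).and <|
    Primrec.eq.comp (snd.comp (snd.comp snd)) (fst.comp snd)

theorem primrecPred_isListCertificate {G : σ → List ProfileList} (hk : Primrec k)
    (hA : Primrec A) (hP : Primrec P) (hG : Primrec G) :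
    PrimrecPred fun s => IsListCertificate (k s) (A s) (P s) (G s) := by
  refine PrimrecPred.and ?_ (PrimrecPred.and ?_ ?_)
  · refine PrimrecPred.ball (list_range.comp hk) (p := fun q => ∀ d ∈ List.range (k q.1),
      ∃ g ∈ G q.1, IsLetterList (k q.1) (A q.1) (P q.1) (q.2, d) g) ?_
    refine PrimrecPred.ball (list_range.comp (hk.comp fst)) (p := fun q =>
      ∃ g ∈ G q.1.1, IsLetterList (k q.1.1) (A q.1.1) (P q.1.1) (q.1.2, q.2) g) ?_
    refine PrimrecPred.bex (hG.comp (fst.comp fst)) (p := fun q =>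
      IsLetterList (k q.1.1.1) (A q.1.1.1) (P q.1.1.1) (q.1.1.2, q.1.2) q.2) ?_
    have c := fst.comp (fst.comp (fst (α := (σ × ℕ) × ℕ) (β := ProfileList)))
    exact primrecPred_isLetterList (hk.comp c) (hA.comp c) (hP.comp c)
      ((snd.comp (fst.comp fst)).pair (snd.comp fst)) snd
  · refine PrimrecPred.ball hG (p := fun q => ∀ h ∈ G q.1, ∃ l ∈ G q.1,
      IsProductList q.2 h l) ?_
    refine PrimrecPred.ball (hG.comp fst) (p := fun q => ∃ l ∈ G q.1.1,
      IsProductList q.1.2 q.2 l) ?_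
    refine PrimrecPred.bex (hG.comp (fst.comp fst)) (p := fun q =>
      IsProductList q.1.1.2 q.1.2 q.2) ?_
    exact primrecPred_isProductList (snd.comp (fst.comp fst)) (snd.comp fst) snd
  · refine PrimrecPred.ball hG (p := fun q => ∀ e ∈ G q.1, ¬ IsProductList e e e ∨
      ¬ IsProductList q.2 e q.2 ∨
      (¬ AcceptsLists (A q.1) (P q.1) 2 q.2 e ∨ AcceptsLists (A q.1) (P q.1) 0 q.2 e) ∧
      (¬ AcceptsLists (A q.1) (P q.1) 1 q.2 e ∨ AcceptsLists (A q.1) (P q.1) 5 q.2 e) ∧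
      (¬ AcceptsLists (A q.1) (P q.1) 2 q.2 e ∨ AcceptsLists (A q.1) (P q.1) 4 q.2 e) ∧
      (¬ (AcceptsLists (A q.1) (P q.1) 3 q.2 e ∧ AcceptsLists (A q.1) (P q.1) 4 q.2 e ∧
        AcceptsLists (A q.1) (P q.1) 0 q.2 e) ∨ AcceptsLists (A q.1) (P q.1) 6 q.2 e)) ?_
    have acc (i : ℕ) : PrimrecPred fun q : (σ × ProfileList) × ProfileList =>
        AcceptsLists (A q.1.1) (P q.1.1) i q.1.2 q.2 :=
      primrecPred_acceptsLists (hA.comp (fst.comp fst)) (hP.comp (fst.comp fst)) i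
        (snd.comp fst) snd
    have idem : PrimrecPred fun q : (σ × ProfileList) × ProfileList => IsProductList q.2 q.2 q.2 :=
      primrecPred_isProductList snd snd snd
    have absorb : PrimrecPred fun q : (σ × ProfileList) × ProfileList =>
        IsProductList q.1.2 q.2 q.1.2 :=
      primrecPred_isProductList (snd.comp fst) snd (snd.comp fst)
    exact PrimrecPred.ball (hG.comp fst) (idem.not.or (absorb.not.or
      (((acc 2).not.or (acc 0)).and (((acc 1).not.or (acc 5)).and
        (((acc 2).not.or (acc 4)).and (((acc 3).and ((acc 4).and (acc 0))).not.or (acc 6)))))))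

end

theorem primrec_diagonal : Primrec diagonal := by
  refine (primrec_equivProd_symm.comp ((primrec_initial Primrec.id).pair
    ((listFilterMap (primrec_transitions Primrec.id)
      (g := fun _ t => if t.2.1.1 = t.2.1.2 then some (t.1, t.2.1.1, t.2.2) else none) ?_).pair
        (primrec_accepting Primrec.id)))).of_eq fun P => rfl
  have c : Primrec fun q : BuchiAutomaton (ℕ × ℕ) × (ℕ × (ℕ × ℕ) × ℕ) => q.2.2.1 :=
    fst.comp (snd.comp snd)
  exact ite (Primrec.eq.comp (fst.comp c) (snd.comp c))
    (option_some.comp ((fst.comp snd).pair ((fst.comp c).pair (snd.comp (snd.comp snd)))))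
    (const none)

/-! ### The unbounded search -/

open Classical in
/-- The `n`-th attempt to find an automaton together with a certificate for it. -/
noncomputable def attempt (p : ℕ × BuchiAutomaton (ℕ × ℕ)) (n : ℕ) : Option (BuchiAutomaton ℕ) :=
  (Encodable.decode n : Option (BuchiAutomaton (ℕ × ℕ) × List ProfileList)).bind fun c =>
    if IsListCertificate p.1 p.2 c.1 c.2 then some c.1.diagonal else none

open Classical in
theorem primrec_attempt : Primrec₂ attempt :=
  option_bind (Primrec.decode.comp snd) (ite (primrecPred_isListCertificate
    (fst.comp (fst.comp fst)) (snd.comp (fst.comp fst)) (fst.comp snd) (snd.comp snd))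
    (option_some.comp (primrec_diagonal.comp (fst.comp snd))) (const none))

/-- The search for an automaton together with a certificate for it. -/
noncomputable def search (p : ℕ × BuchiAutomaton (ℕ × ℕ)) : Part (BuchiAutomaton ℕ) :=
  Nat.rfindOpt (attempt p)

theorem partrec_search : Partrec search :=
  Partrec.rfindOpt primrec_attempt.to_comp

/-- The code of `P` with a certificate makes some attempt succeed, so the search halts. It may stop
at another automaton `P'`, which is correct because it too comes with a certificate. -/
theorem exists_mem_search {k : ℕ} {A P : BuchiAutomaton (ℕ × ℕ)} (h : Selects k A P) :
    ∃ P', Selects k A P' ∧ diagonal P' ∈ search (k, A) := by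
  have spec : ∀ n B, B ∈ attempt (k, A) n → ∃ P', Selects k A P' ∧ diagonal P' = B := by
    intro n B hB
    obtain ⟨⟨P', G⟩, -, hB⟩ := Option.bind_eq_some_iff.1 hB
    split_ifs at hB with hc
    exact ⟨P', exists_isListCertificate_iff.1 ⟨G, hc⟩, Option.some_inj.1 hB⟩
  obtain ⟨G, hG⟩ := exists_isListCertificate_iff.2 h
  have hdom : (search (k, A)).Dom := Nat.rfindOpt_dom.2
    ⟨Encodable.encode (P, G), P.diagonal, by simp [attempt, hG]⟩
  obtain ⟨B, hB⟩ := Part.dom_iff_mem.1 hdom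
  obtain ⟨n, hn⟩ := Nat.rfindOpt_spec hB
  obtain ⟨P', hP', rfl⟩ := spec n B hn
  exact ⟨P', hP', hB⟩

theorem exists_selects {k : ℕ} {A : BuchiAutomaton (ℕ × ℕ)} {D : Set (ℕ → Fin k)}
    {r : (ℕ → Fin k) → (ℕ → Fin k) → Prop} (hr : IsEquivalenceOn D r)
    (hA : ∀ x y, r x y ↔ A.Rel x y) (hc : (classesOn D r).Countable) : ∃ P, Selects k A P := by
  have hreg : Reg {w : ℕ → Fin k × Fin k | r (fun n => (w n).1) fun n => (w n).2} := by
    convert A.reg.comap fun a : Fin k × Fin k => ((a.1 : ℕ), (a.2 : ℕ)) using 1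
    exact Set.ext fun w => hA _ _
  obtain ⟨R, hR, hRD, hRc⟩ := (met_and_exists_representatives hr hreg hc).2
  -- `P` relates each word of `D` to the representative of its class; its letters are then renamed
  -- to natural numbers.
  obtain ⟨P, hP⟩ := (hreg.inter (hR.comap Prod.snd)).isOmegaRegular
  let c : Fin k × Fin k → ℕ × ℕ := fun a => (a.1, a.2)
  have hrel : ∀ x y : ℕ → Fin k, (P.mapLetters c).Rel x y ↔ r x y ∧ y ∈ R := by
    intro x y
    refine mapLetters_accepts.trans (Iff.trans ?_ (hP (convolution x y)).symm)
    constructor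
    · rintro ⟨w, hw, hw'⟩
      have : w = convolution x y := funext fun n => by
        have := Prod.mk.inj (hw n)
        exact Prod.ext (Fin.ext this.1) (Fin.ext this.2)
      rwa [this] at hw'
    · exact fun h => ⟨_, fun n => rfl, h⟩
  refine ⟨P.mapLetters c, fun x y => ?_⟩
  simp only [hrel, ← hA]
  refine ⟨fun h => h.1, fun hx => ?_, fun h => ⟨hr.refl (hr.mem h.1).2, h.2⟩, ?_⟩
  · obtain ⟨y, ⟨hy, hxy⟩, -⟩ := hRc _ ⟨x, (hr.mem hx).1, rfl⟩
    exact ⟨y, hxy, hy⟩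
  · rintro ⟨⟨hx, hxR⟩, ⟨hy, hyR⟩, hxy⟩
    exact (hRc _ ⟨x, (hr.mem hx).1, rfl⟩).unique ⟨hxR, hx⟩ ⟨hyR, hxy⟩

theorem Selects.isRepresentativeSet {k : ℕ} {A P : BuchiAutomaton (ℕ × ℕ)} {D : Set (ℕ → Fin k)}
    {r : (ℕ → Fin k) → (ℕ → Fin k) → Prop} (hr : IsEquivalenceOn D r)
    (hA : ∀ x y, r x y ↔ A.Rel x y) (hP : Selects k A P) :
    IsRepresentativeSet D r {x | P.diagonal.Accepts (natWord x)} := by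
  have hmem : ∀ x : ℕ → Fin k, P.diagonal.Accepts (natWord x) ↔ P.Rel x x := fun x =>
    diagonal_accepts
  refine ⟨fun x hx => (hr.mem ((hA x x).2 ((hP x x).1 ((hmem x).1 hx)))).1, ?_⟩
  rintro _ ⟨x, hx, rfl⟩
  obtain ⟨y, hy⟩ := (hP x x).2.1 ((hA x x).1 (hr.refl hx))
  have hxy := (hA x y).2 ((hP x y).1 hy)
  refine ⟨y, ⟨(hmem y).2 ((hP x y).2.2.1 hy), hxy⟩, ?_⟩
  rintro z ⟨hz, hxz⟩
  exact (hP z y).2.2.2 ⟨(hmem z).1 hz, (hP x y).2.2.1 hy,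
    (hA z y).1 (hr.trans (hr.symm hxz) hxy)⟩

end BuchiAutomaton

theorem mainTheorem3 :
    -- The equivalence, and the existence of an ω-regular set of unique representatives.
    (∀ (S : Type*) [Finite S] (D : Set (ℕ → S)) (r : (ℕ → S) → (ℕ → S) → Prop),
      IsEquivalenceOn D r → IsOmegaRegularRel r →
        ∃ C : ℕ,
          ((classesOn D r).Countable ↔ MetByEqualEndsClasses D r C) ∧
          ((classesOn D r).Countable →
            ∃ R : Set (ℕ → S), IsOmegaRegular R ∧ IsRepresentativeSet D r R)) ∧
    -- One algorithm, given the size `k` of the alphabet and an automaton for an equivalence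
    -- relation with countably many classes, halts with an automaton for such a set.
    (∃ f : ℕ × BuchiAutomaton (ℕ × ℕ) →. BuchiAutomaton ℕ, Partrec f ∧
      ∀ (k : ℕ) (A : BuchiAutomaton (ℕ × ℕ)) (D : Set (ℕ → Fin k))
        (r : (ℕ → Fin k) → (ℕ → Fin k) → Prop),
        IsEquivalenceOn D r →
        (∀ x y, r x y ↔ A.Accepts (convolution (natWord x) (natWord y))) →
        (classesOn D r).Countable →
          ∃ B ∈ f (k, A), IsRepresentativeSet D r {x | B.Accepts (natWord x)}) := by
  refine ⟨fun S _ D r hr hreg => ?_, BuchiAutomaton.search, BuchiAutomaton.partrec_search,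
    fun k A D r hr hA hc => ?_⟩
  · by_cases hc : (classesOn D r).Countable
    · obtain ⟨⟨C, hC⟩, R, hR, hR'⟩ := met_and_exists_representatives hr hreg.reg hc
      exact ⟨C, ⟨fun _ => hC, fun _ => hc⟩, fun _ => ⟨R, hR.isOmegaRegular, hR'⟩⟩
    -- With uncountably many classes any constant would do: both sides of the equivalence fail.
    · exact ⟨0, ⟨fun h => (hc h).elim, fun h => (hc (countable_of_metByEqualEndsClasses hr h)).elim⟩,
        fun h => (hc h).elim⟩
  · obtain ⟨P, hP⟩ := BuchiAutomaton.exists_selects hr hA hc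
    obtain ⟨P', hP', hmem⟩ := BuchiAutomaton.exists_mem_search hP
    exact ⟨_, hmem, hP'.isRepresentativeSet hr hA⟩
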